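/- Let $\mathcal A',\mathcal A,\mathcal A''$ be abelian categories, where $\mathcal A''$ has all small colimits and satisfies AB5 (filtered colimits are exact), and let $$T:\mathcal A'\times\mathcal A\to\mathcal A'',\qquad H:\mathcal A^{op}\times\mathcal A''\to\mathcal A',\qquad C:\mathcal A'^{op}\times\mathcal A''\to\mathcal A$$ be a biadditive adjunction of two variables, i.e. functors, additive in each variable, with natural isomorphisms $\mathcal A''(T(X',X),X'')\cong\mathcal A'(X',H(X,X''))\cong\mathcal A(X,C(X',X''))$. An object $P'$ of $\mathcal A'$ is flat if $T(P',-)$ preserves monomorphisms, and an object $P$ of $\mathcal A$ is flat if $T(-,P)$ preserves monomorphisms; let $\mathcal F'$, $\mathcal F$ be the classes of flat objects. For a class $\mathcal K$ of objects of an abelian category, $\mathcal K^\perp$ (resp. ${}^\perp\mathcal K$) is the class of objects $X$ such that every morphism to $X$ extends along every monomorphism with cokernel in $\mathcal K$ (resp. every morphism from $X$ lifts along every epimorphism with kernel in $\mathcal K$). Suppose that $(\mathcal F',\mathcal F'^\perp)$ and $(\mathcal F,\mathcal F^\perp)$ are left complete cotorsion theories; here $(\mathcal X,\mathcal Y)$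 is a cotorsion theory if $\mathcal X={}^\perp\mathcal Y$ and $\mathcal Y=\mathcal X^\perp$, and it is left complete if every object $M$ sits in a short exact sequence $0\to Y\to X\to M\to 0$ with $Y\in\mathcal Y$, $X\in\mathcal X$. A complete flat resolution of an object $M$ is a quasi-isomorphism $\mathbf R\to S^0(M)$ (with $S^0(M)$ the complex $M$ in degree $0$), where $\mathbf R$ is a degreewise flat chain complex with $\mathbf R_n=0$ for $n<0$ whose boundaries $B_n(\mathbf R)$ all lie in $\mathcal F'^\perp$ (resp. $\mathcal F^\perp$). For chain complexes $\mathbf C'$, $\mathbf C$ indexed by $\mathbb Z$ in $\mathcal A'$, $\mathcal A$, the complex $T(\mathbf C',\mathbf C)$ has $T(\mathbf C',\mathbf C)_n=\bigoplus_{p+q=n}T(\mathbf C'_p,\mathbf C_q)$ with differential $T(d'_p,1)+(-1)^pT(1,d_q)$ on the summand $(p,q)$. Set $\mathsf{Tor}_n(A',A)=H_n(T(\mathbf R',\mathbf R))$, where $\mathbf R'$, $\mathbf R$ are complete flat resolutions of $A'$, $A$. Homology is regarded as a complex with zero differential. The inclusions of cycles induce $z:T(Z(\mathbf C'),Z(\mathbf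 C))\to Z(T(\mathbf C',\mathbf C))$, and $\gamma:T(H(\mathbf C'),H(\mathbf C))\to H(T(\mathbf C',\mathbf C))$ is the unique morphism whose composite with the epimorphism $T(Z(\mathbf C'),Z(\mathbf C))\to T(H(\mathbf C'),H(\mathbf C))$ is $z$ followed by the projection $Z(T(\mathbf C',\mathbf C))\to H(T(\mathbf C',\mathbf C))$. Then every object of $\mathcal A'$ and of $\mathcal A$ has a complete flat resolution. Moreover, let $\mathbf C'$, $\mathbf C$ be chain complexes indexed by $\mathbb Z$ in $\mathcal A'$, $\mathcal A$ such that the boundaries $B_n(\mathbf C)$ and the cycles $Z_n(\mathbf C)$ are flat for all $n$. Then, for every choice of the complete flat resolutions of the objects $H_p(\mathbf C')$ and $H_q(\mathbf C)$ ($p,q\in\mathbb Z$) used to define $\mathsf{Tor}_1$, there is a short exact sequence of complexes (with zero differential) in $\mathcal A''$ $$0\to T(H(\mathbf C'),H(\mathbf C))\xrightarrow{\ \gamma\ }H(T(\mathbf C',\mathbf C))\to\mathsf{Tor}_1(H(\mathbf C'),H(\mathbf C))\to 0,$$ where $\mathsf{Tor}_1(H(\mathbf C'),H(\mathbf C))_n=\bigoplus_{p+q=n}\mathsf{Tor}_1(H_p(\mathbf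 C'),H_{q-1}(\mathbf C))$. -/

import Mathlib

open CategoryTheory Limits

universe v₁ v₂ v₃ v u₁ u₂ u₃ u

noncomputable section

namespace THCKunneth

/-! ### Cotorsion theories -/

section Cotorsion

variable {A : Type u} [Category.{v} A] [Abelian A]

/-- `K^⊥`: the objects `X` such that every morphism to `X` extends along every monomorphism
whose cokernel is in `K`. -/
def rightPerp (K : ObjectProperty A) : ObjectProperty A := fun X =>
  ∀ ⦃Y Z : A⦄ (i : Y ⟶ Z) [Mono i], K (cokernel i) → ∀ f : Y ⟶ X, ∃ g : Z ⟶ X, i ≫ g = f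

/-- `^⊥K`: the objects `X` such that every morphism from `X` lifts along every epimorphism
whose kernel is in `K`. -/
def leftPerp (K : ObjectProperty A) : ObjectProperty A := fun X =>
  ∀ ⦃Y Z : A⦄ (p : Y ⟶ Z) [Epi p], K (kernel p) → ∀ f : X ⟶ Z, ∃ g : X ⟶ Y, g ≫ p = f

/-- `(X, Y)` is a cotorsion theory: `X = ^⊥Y` and `Y = X^⊥`. -/
structure IsCotorsionTheory (X Y : ObjectProperty A) : Prop where
  left_eq : X = leftPerp Y
  right_eq : Y = rightPerp X

/-- `(X, Y)` is a left complete cotorsion theory: moreover, every object `M` sits in a short exact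
sequence `0 ⟶ V ⟶ U ⟶ M ⟶ 0` with `V` in `Y` and `U` in `X`. -/
structure IsLeftCompleteCotorsionTheory (X Y : ObjectProperty A) : Prop
    extends IsCotorsionTheory X Y where
  exists_shortExact (M : A) : ∃ (V U : A) (i : V ⟶ U) (p : U ⟶ M) (w : i ≫ p = 0),
    Y V ∧ X U ∧ (ShortComplex.mk i p w).ShortExact

/-- The degree `n` boundaries of a chain complex: the image of `d : C_{n+1} ⟶ C_n`. -/
abbrev boundaries (C : ChainComplex A ℤ) (n : ℤ) : A := Limits.image (C.d (n + 1) n)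

/-- A complete `K`-resolution of `M`: a quasi-isomorphism `π` from a complex which is degreewise
in `K` and zero in negative degrees to `M` in degree `0`, such that all the boundaries
are in `K^⊥`. -/
structure CompleteResolution (K : ObjectProperty A) (M : A) where
  complex : ChainComplex A ℤ
  mem (n : ℤ) : K (complex.X n)
  isZero (n : ℤ) (hn : n < 0) : IsZero (complex.X n)
  π : complex ⟶ (HomologicalComplex.single A (ComplexShape.down ℤ) 0).obj M
  quasiIso : QuasiIso π
  boundaries_mem (n : ℤ) : rightPerp K (boundaries complex n)

/-- A family of objects as a complex with zero differential. -/
@[simps]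
def zeroComplex (X : ℤ → A) : ChainComplex A ℤ where
  X := X
  d _ _ := 0

/-- The homology of a chain complex, as a complex with zero differential. -/
abbrev homologyComplex (C : ChainComplex A ℤ) : ChainComplex A ℤ :=
  zeroComplex (fun n => C.homology n)

/-- If `F` is a left adjoint, `F(H_n(C))` is the cokernel of `F(C_{n+1}) ⟶ F(Z_n(C))`. -/
def descHomology {B : Type u₁} [Category.{v₁} B] [Preadditive B] (F : A ⥤ B) [F.Additive]
    [F.IsLeftAdjoint] (C : ChainComplex A ℤ) (n : ℤ) {Y : B} (g : F.obj (C.cycles n) ⟶ Y)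
    (hg : F.map (C.toCycles (n + 1) n) ≫ g = 0) : F.obj (C.homology n) ⟶ Y :=
  haveI : PreservesColimits F := (Adjunction.ofIsLeftAdjoint F).leftAdjoint_preservesColimits
  (CokernelCofork.mapIsColimit _ (C.homologyIsCokernel (n + 1) n (by simp)) F).desc
    (CokernelCofork.ofπ g hg)

lemma π_descHomology {B : Type u₁} [Category.{v₁} B] [Preadditive B] (F : A ⥤ B) [F.Additive]
    [F.IsLeftAdjoint] (C : ChainComplex A ℤ) (n : ℤ) {Y : B} (g : F.obj (C.cycles n) ⟶ Y)
    (hg : F.map (C.toCycles (n + 1) n) ≫ g = 0) :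
    F.map (C.homologyπ n) ≫ descHomology F C n g hg = g :=
  haveI : PreservesColimits F := (Adjunction.ofIsLeftAdjoint F).leftAdjoint_preservesColimits
  (CokernelCofork.mapIsColimit _ (C.homologyIsCokernel (n + 1) n (by simp)) F).fac
    (CokernelCofork.ofπ g hg) WalkingParallelPair.one

end Cotorsion

/-! ### Biadditive tensor-hom-cotensor situations -/

/-- A biadditive tensor-hom-cotensor situation (an adjunction of two variables, with `T`
additive in each variable). -/
structure BiadditiveTHC (A₁ : Type u₁) (A₂ : Type u₂) (A₃ : Type u₃)
    [Category.{v₁} A₁] [Category.{v₂} A₂] [Category.{v₃} A₃]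
    [Preadditive A₁] [Preadditive A₂] [Preadditive A₃] where
  T : A₁ ⥤ A₂ ⥤ A₃
  hom : A₂ᵒᵖ ⥤ A₃ ⥤ A₁
  cot : A₁ᵒᵖ ⥤ A₃ ⥤ A₂
  adjHom : T.flip ⊣₂ hom
  adjCot : T ⊣₂ cot
  additive_left : T.Additive
  additive_right (X₁ : A₁) : (T.obj X₁).Additive

attribute [instance] BiadditiveTHC.additive_left BiadditiveTHC.additive_right

/-- In the total complex of a tensor product of chain complexes indexed by `ℤ`, the differential
of the second factor carries the sign `(-1)^p` on the summand of bidegree `(p, q)`. -/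
instance tensorSignsDownInt : (ComplexShape.down ℤ).TensorSigns where
  ε' := MonoidHom.mk' (fun i : Multiplicative ℤ => Int.negOnePow i.toAdd)
    (fun a b => Int.negOnePow_add a.toAdd b.toAdd)
  rel_add p q r hpq := by
    have h : q + 1 = p := hpq
    change q + r + 1 = p + r
    lia
  add_rel p q r hpq := by
    have h : q + 1 = p := hpq
    change r + q + 1 = r + p
    lia
  ε'_succ p q hpq := by
    have h : q + 1 = p := hpq
    subst h
    change Int.negOnePow q = - Int.negOnePow (q + 1)
    rw [Int.negOnePow_succ, neg_neg]

namespace BiadditiveTHC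

variable {A₁ : Type u₁} {A₂ : Type u₂} {A₃ : Type u₃}
  [Category.{v₁} A₁] [Category.{v₂} A₂] [Category.{v₃} A₃]
  [Abelian A₁] [Abelian A₂] [Abelian A₃]
  (S : BiadditiveTHC A₁ A₂ A₃)

/-- The flat objects of the first category: `T(P, -)` preserves monomorphisms. -/
def flat₁ : ObjectProperty A₁ := fun P =>
  ∀ ⦃X Y : A₂⦄ (f : X ⟶ Y) [Mono f], Mono ((S.T.obj P).map f)

/-- The flat objects of the second category: `T(-, P)` preserves monomorphisms. -/
def flat₂ : ObjectProperty A₂ := fun P =>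
  ∀ ⦃X Y : A₁⦄ (f : X ⟶ Y) [Mono f], Mono ((S.T.map f).app P)

variable [HasColimits A₃] (C₁ : ChainComplex A₁ ℤ) (C₂ : ChainComplex A₂ ℤ)

/-- `T(C₁, C₂)`: in degree `n` it is the coproduct of the `T((C₁)_p, (C₂)_q)` with `p + q = n`;
the differential is `T(d, 1) + (-1)^p T(1, d)` on the summand of bidegree `(p, q)`. -/
abbrev tensor : ChainComplex A₃ ℤ :=
  HomologicalComplex.mapBifunctor C₁ C₂ S.T (ComplexShape.down ℤ)

/-- The inclusion of the summand of bidegree `(p, q)`. -/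
abbrev ι (p q n : ℤ) (h : p + q = n) :
    (S.T.obj (C₁.X p)).obj (C₂.X q) ⟶ (S.tensor C₁ C₂).X n :=
  HomologicalComplex.ιMapBifunctor C₁ C₂ S.T (ComplexShape.down ℤ) p q n h

lemma ι_d (p q n p' q' n' : ℤ) (h : p + q = n) (hp : p' + 1 = p) (hq : q' + 1 = q)
    (hn : n' + 1 = n) :
    S.ι C₁ C₂ p q n h ≫ (S.tensor C₁ C₂).d n n' =
      (S.T.map (C₁.d p p')).app (C₂.X q) ≫ S.ι C₁ C₂ p' q n' (by lia) +
      Int.negOnePow p • ((S.T.obj (C₁.X p)).map (C₂.d q q') ≫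
        S.ι C₁ C₂ p q' n' (by lia)) := by
  rw [HomologicalComplex.mapBifunctor.d_eq, Preadditive.comp_add,
    HomologicalComplex.mapBifunctor.ι_D₁, HomologicalComplex.mapBifunctor.ι_D₂,
    HomologicalComplex.mapBifunctor.d₁_eq C₁ C₂ S.T (ComplexShape.down ℤ)
      (show (ComplexShape.down ℤ).Rel p p' from hp) q n' (show p' + q = n' by lia),
    HomologicalComplex.mapBifunctor.d₂_eq C₁ C₂ S.T (ComplexShape.down ℤ) p
      (show (ComplexShape.down ℤ).Rel q q' from hq) n' (show p + q' = n' by lia)]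
  congr 1
  exact one_smul ℤˣ _

/-- The component `T(Z_p(C₁), Z_q(C₂)) ⟶ Z_n(T(C₁, C₂))` of the morphism
`z : T(Z(C₁), Z(C₂)) ⟶ Z(T(C₁, C₂))` induced by the inclusions of cycles. -/
def cyclesMap (p q n : ℤ) (h : p + q = n) :
    (S.T.obj (C₁.cycles p)).obj (C₂.cycles q) ⟶ (S.tensor C₁ C₂).cycles n :=
  (S.tensor C₁ C₂).liftCycles
    ((S.T.map (C₁.iCycles p)).app (C₂.cycles q) ≫
      (S.T.obj (C₁.X p)).map (C₂.iCycles q) ≫ S.ι C₁ C₂ p q n h) (n - 1) (by simp) (by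
    rw [Category.assoc, Category.assoc,
      S.ι_d C₁ C₂ p q n (p - 1) (q - 1) (n - 1) h (by lia) (by lia) (by lia)]
    have h₁ : (S.T.map (C₁.iCycles p)).app (C₂.cycles q) ≫
        (S.T.map (C₁.d p (p - 1))).app (C₂.cycles q) = 0 := by
      rw [← NatTrans.comp_app, ← Functor.map_comp, C₁.iCycles_d, Functor.map_zero, zero_app]
    have h₂ : (S.T.obj (C₁.X p)).map (C₂.iCycles q) ≫
        (S.T.obj (C₁.X p)).map (C₂.d q (q - 1)) = 0 := by
      rw [← Functor.map_comp, C₂.iCycles_d, Functor.map_zero]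
    rw [Preadditive.comp_add, Linear.comp_units_smul, NatTrans.naturality_assoc,
      reassoc_of% h₂, zero_comp, smul_zero, add_zero, reassoc_of% h₁, zero_comp])

lemma cyclesMap_i (p q n : ℤ) (h : p + q = n) :
    S.cyclesMap C₁ C₂ p q n h ≫ (S.tensor C₁ C₂).iCycles n =
      (S.T.map (C₁.iCycles p)).app (C₂.cycles q) ≫
        (S.T.obj (C₁.X p)).map (C₂.iCycles q) ≫ S.ι C₁ C₂ p q n h :=
  HomologicalComplex.liftCycles_i _ _ _ _ _

instance isLeftAdjoint_right (X₁ : A₁) : (S.T.obj X₁).IsLeftAdjoint :=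
  (S.adjCot.adj X₁).isLeftAdjoint

instance isLeftAdjoint_left (X₂ : A₂) : (S.T.flip.obj X₂).IsLeftAdjoint :=
  (S.adjHom.adj X₂).isLeftAdjoint

instance additive_flip (X₂ : A₂) : (S.T.flip.obj X₂).Additive where
  map_add {X Y f g} := by
    change (S.T.map (f + g)).app X₂ = (S.T.map f).app X₂ + (S.T.map g).app X₂
    rw [Functor.map_add, NatTrans.app_add]

lemma map_toCycles_cyclesMap (p q n : ℤ) (h : p + q = n) :
    (S.T.flip.obj (C₂.cycles q)).map (C₁.toCycles (p + 1) p) ≫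
      S.cyclesMap C₁ C₂ p q n h ≫ (S.tensor C₁ C₂).homologyπ n = 0 := by
  have key : (S.T.flip.obj (C₂.cycles q)).map (C₁.toCycles (p + 1) p) ≫
      S.cyclesMap C₁ C₂ p q n h =
      ((S.T.obj (C₁.X (p + 1))).map (C₂.iCycles q) ≫ S.ι C₁ C₂ (p + 1) q (n + 1) (by lia)) ≫
        (S.tensor C₁ C₂).toCycles (n + 1) n := by
    rw [← cancel_mono ((S.tensor C₁ C₂).iCycles n), Category.assoc, Category.assoc,
      cyclesMap_i, HomologicalComplex.toCycles_i, Category.assoc,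
      S.ι_d C₁ C₂ (p + 1) q (n + 1) p (q - 1) n (by lia) rfl (by lia) rfl]
    have h₁ : (S.T.flip.obj (C₂.cycles q)).map (C₁.toCycles (p + 1) p) ≫
        (S.T.map (C₁.iCycles p)).app (C₂.cycles q) =
        (S.T.map (C₁.d (p + 1) p)).app (C₂.cycles q) := by
      change (S.T.map (C₁.toCycles (p + 1) p)).app (C₂.cycles q) ≫ _ = _
      rw [← NatTrans.comp_app, ← Functor.map_comp, HomologicalComplex.toCycles_i]
    have h₂ : (S.T.obj (C₁.X (p + 1))).map (C₂.iCycles q) ≫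
        (S.T.obj (C₁.X (p + 1))).map (C₂.d q (q - 1)) = 0 := by
      rw [← Functor.map_comp, C₂.iCycles_d, Functor.map_zero]
    rw [reassoc_of% h₁, Preadditive.comp_add, Linear.comp_units_smul, reassoc_of% h₂, zero_comp,
      smul_zero, add_zero, NatTrans.naturality_assoc]
  rw [reassoc_of% key, HomologicalComplex.toCycles_comp_homologyπ, comp_zero, comp_zero]

lemma cyclesMap_toCycles (p q n : ℤ) (h : p + q = n) :
    (S.T.obj (C₁.cycles p)).map (C₂.toCycles (q + 1) q) ≫
      S.cyclesMap C₁ C₂ p q n h ≫ (S.tensor C₁ C₂).homologyπ n = 0 := by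
  have key : (S.T.obj (C₁.cycles p)).map (C₂.toCycles (q + 1) q) ≫
      S.cyclesMap C₁ C₂ p q n h =
      Int.negOnePow p • (((S.T.map (C₁.iCycles p)).app (C₂.X (q + 1)) ≫
        S.ι C₁ C₂ p (q + 1) (n + 1) (by lia)) ≫ (S.tensor C₁ C₂).toCycles (n + 1) n) := by
    rw [← cancel_mono ((S.tensor C₁ C₂).iCycles n), Category.assoc, Linear.units_smul_comp,
      Category.assoc, cyclesMap_i, HomologicalComplex.toCycles_i, Category.assoc,
      S.ι_d C₁ C₂ p (q + 1) (n + 1) (p - 1) q n (by lia) (by lia) rfl rfl]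
    have h₁ : (S.T.map (C₁.iCycles p)).app (C₂.X (q + 1)) ≫
        (S.T.map (C₁.d p (p - 1))).app (C₂.X (q + 1)) = 0 := by
      rw [← NatTrans.comp_app, ← Functor.map_comp, C₁.iCycles_d, Functor.map_zero, zero_app]
    rw [Preadditive.comp_add, Linear.comp_units_smul, reassoc_of% h₁, zero_comp, zero_add,
      smul_smul, Int.units_mul_self, one_smul, ← NatTrans.naturality_assoc,
      ← NatTrans.naturality_assoc, ← Functor.map_comp_assoc, HomologicalComplex.toCycles_i]
  rw [reassoc_of% key, Linear.units_smul_comp, Category.assoc, Category.assoc,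
    HomologicalComplex.toCycles_comp_homologyπ, comp_zero, comp_zero, smul_zero]

/-- The morphism `T(H_p(C₁), Z_q(C₂)) ⟶ H_n(T(C₁, C₂))` induced by `cyclesMap`. -/
def γAux (p q n : ℤ) (h : p + q = n) :
    (S.T.obj (C₁.homology p)).obj (C₂.cycles q) ⟶ (S.tensor C₁ C₂).homology n :=
  descHomology (S.T.flip.obj (C₂.cycles q)) C₁ p
    (S.cyclesMap C₁ C₂ p q n h ≫ (S.tensor C₁ C₂).homologyπ n)
    (S.map_toCycles_cyclesMap C₁ C₂ p q n h)

lemma π_γAux (p q n : ℤ) (h : p + q = n) :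
    (S.T.map (C₁.homologyπ p)).app (C₂.cycles q) ≫ S.γAux C₁ C₂ p q n h =
      S.cyclesMap C₁ C₂ p q n h ≫ (S.tensor C₁ C₂).homologyπ n :=
  π_descHomology (S.T.flip.obj (C₂.cycles q)) C₁ p _ _

instance epi_map_app {X Y : A₁} (f : X ⟶ Y) [Epi f] (X₂ : A₂) : Epi ((S.T.map f).app X₂) :=
  inferInstanceAs (Epi ((S.T.flip.obj X₂).map f))

lemma toCycles_γAux (p q n : ℤ) (h : p + q = n) :
    (S.T.obj (C₁.homology p)).map (C₂.toCycles (q + 1) q) ≫ S.γAux C₁ C₂ p q n h = 0 := by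
  rw [← cancel_epi ((S.T.map (C₁.homologyπ p)).app (C₂.X (q + 1))), comp_zero,
    ← NatTrans.naturality_assoc, π_γAux, cyclesMap_toCycles]

/-- The component `T(H_p(C₁), H_q(C₂)) ⟶ H_n(T(C₁, C₂))` of `γ`. -/
def γComponent (p q n : ℤ) (h : p + q = n) :
    (S.T.obj (C₁.homology p)).obj (C₂.homology q) ⟶ (S.tensor C₁ C₂).homology n :=
  descHomology (S.T.obj (C₁.homology p)) C₂ q (S.γAux C₁ C₂ p q n h)
    (S.toCycles_γAux C₁ C₂ p q n h)

/-- `γ` is the morphism such that `γ ∘ T(p', p) = p'' ∘ z`, where `p'`, `p`, `p''` are the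
projections from cycles to homology, and `z : T(Z(C₁), Z(C₂)) ⟶ Z(T(C₁, C₂))`. -/
lemma π_γComponent (p q n : ℤ) (h : p + q = n) :
    (S.T.map (C₁.homologyπ p)).app (C₂.cycles q) ≫
      (S.T.obj (C₁.homology p)).map (C₂.homologyπ q) ≫ S.γComponent C₁ C₂ p q n h =
      S.cyclesMap C₁ C₂ p q n h ≫ (S.tensor C₁ C₂).homologyπ n := by
  have h₂ : (S.T.obj (C₁.homology p)).map (C₂.homologyπ q) ≫ S.γComponent C₁ C₂ p q n h =
      S.γAux C₁ C₂ p q n h := π_descHomology _ _ _ _ _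
  rw [h₂, π_γAux]

lemma tensor_zeroComplex_d (X₁ : ℤ → A₁) (X₂ : ℤ → A₂) (n n' : ℤ) (hn : n' + 1 = n) :
    (S.tensor (zeroComplex X₁) (zeroComplex X₂)).d n n' = 0 := by
  apply HomologicalComplex.mapBifunctor.hom_ext
  intro p q h
  rw [comp_zero]
  refine (S.ι_d _ _ p q n (p - 1) (q - 1) n' h (by lia) (by lia) hn).trans ?_
  have h₁ : S.T.map ((zeroComplex X₁).d p (p - 1)) = 0 := S.T.map_zero _ _
  have h₂ : (S.T.obj ((zeroComplex X₁).X p)).map ((zeroComplex X₂).d q (q - 1)) = 0 :=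
    Functor.map_zero _ _ _
  rw [h₁, h₂, zero_app, zero_comp, zero_comp, smul_zero, add_zero]

/-- The natural morphism `γ : T(H(C₁), H(C₂)) ⟶ H(T(C₁, C₂))`, where homology is regarded as
a complex with zero differential. It is characterized by `π_γComponent` on each summand. -/
def γ : S.tensor (homologyComplex C₁) (homologyComplex C₂) ⟶
    homologyComplex (S.tensor C₁ C₂) where
  f n := HomologicalComplex.mapBifunctorDesc (fun p q h => S.γComponent C₁ C₂ p q n h)
  comm' n n' hn := by
    rw [S.tensor_zeroComplex_d _ _ n n' hn, zero_comp]
    exact comp_zero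

lemma ι_γ (p q n : ℤ) (h : p + q = n) :
    S.ι (homologyComplex C₁) (homologyComplex C₂) p q n h ≫ (S.γ C₁ C₂).f n =
      S.γComponent C₁ C₂ p q n h :=
  HomologicalComplex.ι_mapBifunctorDesc (K₁ := homologyComplex C₁) (K₂ := homologyComplex C₂)
    (F := S.T) (c := ComplexShape.down ℤ) (fun p q h => S.γComponent C₁ C₂ p q n h) p q h

/-- `Tor_n(X₁, X₂) = H_n(T(R₁, R₂))`, for complete flat resolutions `R₁` of `X₁`
and `R₂` of `X₂`. -/
def tor {X₁ : A₁} {X₂ : A₂} (R₁ : CompleteResolution S.flat₁ X₁)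
    (R₂ : CompleteResolution S.flat₂ X₂) (n : ℤ) : A₃ :=
  (S.tensor R₁.complex R₂.complex).homology n

/-- `Tor₁(H(C₁), H(C₂))`: the complex with zero differential which in degree `n` is the coproduct
of the `Tor₁(H_p(C₁), H_{q-1}(C₂))` for `p + q = n`. -/
def torOneComplex (R₁ : ∀ p : ℤ, CompleteResolution S.flat₁ (C₁.homology p))
    (R₂ : ∀ q : ℤ, CompleteResolution S.flat₂ (C₂.homology q)) : ChainComplex A₃ ℤ :=
  zeroComplex (fun n => ∐ fun x : { x : ℤ × ℤ // x.1 + x.2 = n } =>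
    S.tor (R₁ x.1.1) (R₂ (x.1.2 - 1)) 1)

end BiadditiveTHC
end THCKunneth
end

/-! Complete resolutions come from iterating special precovers: the short exact sequences with flat
middle term and kernel in the right class are spliced, and the boundaries of the result are the
successive kernels (`nonempty_completeResolution`).

For the Künneth sequence, write `Z`, `B`, `H` for the cycles, boundaries and homology of `C₂`, with
`B_{q-1}` placed in degree `q`. Then `0 → Z → C₂ → B → 0` is a short exact sequence of complexes
whose outer terms have zero differential. As `B` is flat, `T(C₁, -)` keeps it exact
(`shortExact_tensorMap`), which gives a long exact homology sequence. For a family `G` of flat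
objects, exactness of `T(-, G_q)` and of coproducts makes `H_n(T(C₁, G))` the coproduct of the
`T(H_p(C₁), G_q)` (`isColimitHomology`); this applies to both `Z` and `B`. Under these
identifications the connecting morphism is, up to the sign `(-1)^p`, `T(H_p(C₁), -)` applied to the
inclusion `B_{q-1} → Z_{q-1}` (`hι_δ`). So `H_n(T(C₁, C₂))` is an extension of the kernel of one
such morphism by the cokernel of the next (`exists_shortExact_of_exact`). The cokernel is `T(H(C₁),
H)`, embedded by `γ`.

The kernel is `Tor₁`, because `0 → B → Z → H → 0` has a flat middle term. This rests on two facts.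
The first homology of `T(R₁, R₂)` is the kernel of `T(X₁, K) → T(X₁, (R₂)_0)`, where `K` is the
first syzygy of `R₂` (`nonempty_homology_one_iso`). By the snake lemma against a flat cover of `X₁`,
such a kernel does not depend on the presentation of the second argument (`nonempty_kernel_iso`).
Hence the result holds for every choice of resolutions. -/

noncomputable section

namespace THCKunneth

/-! ### Exactness of coproducts under AB5 -/

section Coproducts

variable {A : Type u} [Category.{v} A] [Abelian A]

/-- A short complex of functors is exact if it is so pointwise. -/
lemma exact_of_evaluation {J : Type u₁} [Category.{v₁} J] (S : ShortComplex (J ⥤ A))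
    (hS : ∀ j, (S.map ((evaluation J A).obj j)).Exact) : S.Exact := by
  rw [ShortComplex.exact_iff_isZero_homology, Functor.isZero_iff]
  intro j
  exact ((ShortComplex.exact_iff_isZero_homology _).1 (hS j)).of_iso
    (S.mapHomologyIso ((evaluation J A).obj j)).symm

/-- Coproducts of exact short complexes are exact. -/
lemma exact_of_isColimit_cofan {J : Type} [HasColimitsOfShape (Discrete J) A]
    [HasExactColimitsOfShape (Discrete J) A] {S : J → ShortComplex A} (hS : ∀ j, (S j).Exact)
    {X : ShortComplex A} (φ : ∀ j, S j ⟶ X)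
    (h₁ : IsColimit (Cofan.mk X.X₁ (fun j => (φ j).τ₁)))
    (h₂ : IsColimit (Cofan.mk X.X₂ (fun j => (φ j).τ₂)))
    (h₃ : IsColimit (Cofan.mk X.X₃ (fun j => (φ j).τ₃))) : X.Exact := by
  let T : ShortComplex (Discrete J ⥤ A) :=
    { X₁ := Discrete.functor (fun j => (S j).X₁)
      X₂ := Discrete.functor (fun j => (S j).X₂)
      X₃ := Discrete.functor (fun j => (S j).X₃)
      f := Discrete.natTrans (fun j => (S j.as).f)
      g := Discrete.natTrans (fun j => (S j.as).g)
      zero := by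
        ext j
        exact (S j.as).zero }
  have hT : T.Exact := exact_of_evaluation T (fun j => hS j.as)
  exact colim.exact_mapShortComplex hT h₁ h₂ h₃ X.f X.g
    (fun j => (φ j.as).comm₁₂) (fun j => (φ j.as).comm₂₃)

/-- Coproducts of monomorphisms are monomorphisms. -/
lemma mono_of_isColimit_cofan {J : Type} [HasColimitsOfShape (Discrete J) A]
    [HasExactColimitsOfShape (Discrete J) A] {X Y : J → A} (f : ∀ j, X j ⟶ Y j)
    (hf : ∀ j, Mono (f j)) {X' Y' : A} (f' : X' ⟶ Y') (a : ∀ j, X j ⟶ X') (b : ∀ j, Y j ⟶ Y')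
    (ha : IsColimit (Cofan.mk X' a)) (hb : IsColimit (Cofan.mk Y' b))
    (comm : ∀ j, a j ≫ f' = f j ≫ b j) : Mono f' := by
  let φ : Discrete.functor X ⟶ Discrete.functor Y := Discrete.natTrans (fun j => f j.as)
  have : ∀ j, Mono (φ.app j) := fun j => hf j.as
  have : Mono φ := NatTrans.mono_of_mono_app φ
  exact colim.map_mono' φ ha hb f' (fun j => comm j.as)

/-- A category with exact filtered colimits has exact small discrete colimits. -/
lemma hasExactColimitsOfShape_discrete [HasColimits A] [AB5 A] (J : Type) :
    HasExactColimitsOfShape (Discrete J) A := by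
  have : HasFiniteBiproducts A := Abelian.hasFiniteBiproducts
  -- AB5 gives exact coproducts in universe `v`; the index types used here are small in universe
  -- `0`, so the size has to be lowered.
  have : AB4OfSize.{v} A := AB4.of_AB5 A
  have : AB4OfSize.{0} A := inferInstance
  infer_instance

end Coproducts

/-! ### Complete resolutions by splicing special precovers -/

section Resolutions

variable {A : Type u} [Category.{v} A] [Abelian A] {K : ObjectProperty A}

lemma rightPerp_of_isZero {X : A} (hX : IsZero X) : rightPerp K X :=
  fun _ _ _ _ _ _ => ⟨0, hX.eq_of_tgt _ _⟩

lemma leftPerp_of_isZero {X : A} (hX : IsZero X) : leftPerp K X :=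
  fun _ _ _ _ _ _ => ⟨0, hX.eq_of_src _ _⟩

lemma rightPerp_of_iso {X Y : A} (e : X ≅ Y) (hX : rightPerp K X) : rightPerp K Y := by
  intro V W i _ hi f
  obtain ⟨g, hg⟩ := hX i hi (f ≫ e.inv)
  exact ⟨g ≫ e.hom, by rw [reassoc_of% hg, e.inv_hom_id, Category.comp_id]⟩

namespace IsLeftCompleteCotorsionTheory

variable (h : IsLeftCompleteCotorsionTheory K (rightPerp K)) (M : A)

/-- A special precover of `M` by an object in the left class. -/
def cover : A := (h.exists_shortExact M).choose_spec.choose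

/-- The kernel of the chosen special precover. -/
def syzygy : A := (h.exists_shortExact M).choose

/-- The inclusion of the kernel of the special precover. -/
def syzygyι : h.syzygy M ⟶ h.cover M := (h.exists_shortExact M).choose_spec.choose_spec.choose

/-- The special precover. -/
def coverπ : h.cover M ⟶ M :=
  (h.exists_shortExact M).choose_spec.choose_spec.choose_spec.choose

lemma syzygyι_coverπ : h.syzygyι M ≫ h.coverπ M = 0 :=
  (h.exists_shortExact M).choose_spec.choose_spec.choose_spec.choose_spec.choose

lemma rightPerp_syzygy : rightPerp K (h.syzygy M) :=
  (h.exists_shortExact M).choose_spec.choose_spec.choose_spec.choose_spec.choose_spec.1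

lemma cover_mem : K (h.cover M) :=
  (h.exists_shortExact M).choose_spec.choose_spec.choose_spec.choose_spec.choose_spec.2.1

lemma shortExact_cover : (ShortComplex.mk _ _ (h.syzygyι_coverπ M)).ShortExact :=
  (h.exists_shortExact M).choose_spec.choose_spec.choose_spec.choose_spec.choose_spec.2.2

end IsLeftCompleteCotorsionTheory

/-- Composing an exact sequence with an epimorphism on the left and a monomorphism on the right. -/
lemma exact_epi_comp_mono {X X' Y Z Z' : A} (e : X' ⟶ X) [Epi e] (f : X ⟶ Y) (g : Y ⟶ Z)
    (m : Z ⟶ Z') [Mono m] (w : f ≫ g = 0) (h : (ShortComplex.mk f g w).Exact)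
    (w' : (e ≫ f) ≫ g ≫ m = 0) : (ShortComplex.mk (e ≫ f) (g ≫ m) w').Exact := by
  have h₁ : (ShortComplex.mk (e ≫ f) g (by rw [Category.assoc, w, comp_zero])).Exact := by
    let φ : ShortComplex.mk (e ≫ f) g (by rw [Category.assoc, w, comp_zero]) ⟶
        ShortComplex.mk f g w :=
      { τ₁ := e, τ₂ := 𝟙 _, τ₃ := 𝟙 _ }
    have : Epi φ.τ₁ := inferInstanceAs (Epi e)
    have : IsIso φ.τ₂ := inferInstanceAs (IsIso (𝟙 _))
    have : Mono φ.τ₃ := inferInstanceAs (Mono (𝟙 _))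
    exact (ShortComplex.exact_iff_of_epi_of_isIso_of_mono φ).2 h
  let φ : ShortComplex.mk (e ≫ f) g (by rw [Category.assoc, w, comp_zero]) ⟶
      ShortComplex.mk (e ≫ f) (g ≫ m) w' :=
    { τ₁ := 𝟙 _, τ₂ := 𝟙 _, τ₃ := m }
  have : Epi φ.τ₁ := inferInstanceAs (Epi (𝟙 _))
  have : IsIso φ.τ₂ := inferInstanceAs (IsIso (𝟙 _))
  have : Mono φ.τ₃ := inferInstanceAs (Mono m)
  exact (ShortComplex.exact_iff_of_epi_of_isIso_of_mono φ).1 h₁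

lemma exact_epi_comp {X X' Y Z : A} (e : X' ⟶ X) [Epi e] (f : X ⟶ Y) (g : Y ⟶ Z)
    (w : f ≫ g = 0) (h : (ShortComplex.mk f g w).Exact) (w' : (e ≫ f) ≫ g = 0) :
    (ShortComplex.mk (e ≫ f) g w').Exact := by
  simpa using exact_epi_comp_mono e f g (𝟙 Z) w h (by simpa using w')

lemma exact_of_eq {X Y Z : A} {f f' : X ⟶ Y} {g g' : Y ⟶ Z} (hf : f = f') (hg : g = g')
    (w : f ≫ g = 0) (w' : f' ≫ g' = 0) (h : (ShortComplex.mk f g w).Exact) :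
    (ShortComplex.mk f' g' w').Exact := by
  subst hf hg
  exact h

section Splice

variable {M U : ℕ → A} (i : ∀ n, M (n + 1) ⟶ U n) (p : ∀ n, U n ⟶ M n)
  (w : ∀ n, i n ≫ p n = 0)

variable (U) in
/-- The objects of the complex obtained by splicing short exact sequences. -/
def spliceX : ℤ → A
  | Int.ofNat n => U n
  | Int.negSucc _ => (HasZeroObject.zero' A).zero

/-- The differentials of the complex obtained by splicing short exact sequences. -/
def spliceD : ∀ n : ℤ, spliceX U (n + 1) ⟶ spliceX U n
  | Int.ofNat n => p (n + 1) ≫ i n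
  | Int.negSucc _ => 0

include w in
lemma spliceD_comp_spliceD : ∀ n : ℤ, spliceD i p (n + 1) ≫ spliceD i p n = 0
  | Int.ofNat n => by
    change (p (n + 2) ≫ i (n + 1)) ≫ (p (n + 1) ≫ i n) = 0
    rw [Category.assoc, reassoc_of% w, zero_comp, comp_zero]
  | Int.negSucc _ => comp_zero

/-- The complex obtained by splicing short exact sequences. -/
def splice : ChainComplex A ℤ :=
  ChainComplex.of (spliceX U) (spliceD i p) (spliceD_comp_spliceD i p w)

lemma splice_d (n : ℕ) : (splice i p w).d ((n : ℤ) + 1) n = p (n + 1) ≫ i n :=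
  ChainComplex.of_d (spliceX U) (spliceD i p) (n : ℤ)

lemma isZero_splice_X : ∀ n : ℤ, n < 0 → IsZero ((splice i p w).X n)
  | Int.ofNat n, hn => by
    have : (n : ℤ) < 0 := hn
    lia
  | Int.negSucc _, _ => isZero_zero A

/-- In positive degrees the two differentials are one of the given short exact sequences, preceded
by an epimorphism and followed by a monomorphism, neither of which affects exactness. Degree `0` is
excluded because the homology there is `M 0`. -/
lemma splice_exactAt (hS : ∀ n, (ShortComplex.mk _ _ (w n)).ShortExact) (n : ℤ) (hn : n ≠ 0) :
    (splice i p w).ExactAt n := by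
  obtain hn' | hn' := lt_or_gt_of_ne hn
  · rw [(splice i p w).exactAt_iff' (n + 1) n (n - 1) (by simp) (by simp)]
    exact ShortComplex.exact_of_isZero_X₂ _ (isZero_splice_X i p w n hn')
  · obtain ⟨m, rfl⟩ : ∃ m : ℕ, n = ((m + 1 : ℕ) : ℤ) := ⟨(n - 1).toNat, by lia⟩
    rw [(splice i p w).exactAt_iff' (((m + 1 : ℕ) : ℤ) + 1) ((m + 1 : ℕ) : ℤ) m
      (by simp) (by simp)]
    have := (hS (m + 2)).epi_g
    have := (hS m).mono_f
    have key := exact_epi_comp_mono (p (m + 2)) (i (m + 1)) (p (m + 1)) (i m) (w (m + 1))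
      (hS (m + 1)).exact (by rw [Category.assoc, reassoc_of% w, zero_comp, comp_zero])
    exact exact_of_eq (splice_d i p w (m + 1)).symm (splice_d i p w m).symm _ _ key

end Splice

/-- A morphism to an object in degree `0` from a complex which vanishes in degree `-1` is
a quasi-isomorphism in degree `0` when this object is the cokernel of the differential. -/
lemma quasiIsoAt_zero_iff {R : ChainComplex A ℤ} (hR : IsZero (R.X (-1))) {M : A}
    (π : R ⟶ (HomologicalComplex.single A (ComplexShape.down ℤ) 0).obj M) (ε : R.X 0 ⟶ M)
    (hε : π.f 0 = ε ≫ (HomologicalComplex.singleObjXSelf (ComplexShape.down ℤ) 0 M).inv)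
    (w : R.d 1 0 ≫ ε = 0) :
    QuasiIsoAt π 0 ↔ (ShortComplex.mk (R.d 1 0) ε w).Exact ∧ Epi ε := by
  let e := HomologicalComplex.singleObjXSelf (ComplexShape.down ℤ) 0 M
  rw [quasiIsoAt_iff' _ 1 0 (-1) (by simp) (by simp),
    ShortComplex.quasiIso_iff_of_zeros' _ (hR.eq_of_tgt _ _)
      (HomologicalComplex.single_obj_d (ComplexShape.down ℤ) _ _ _ _)
      (HomologicalComplex.single_obj_d (ComplexShape.down ℤ) _ _ _ _)]
  refine and_congr (ShortComplex.exact_iff_of_iso (ShortComplex.isoMk (Iso.refl _) (Iso.refl _)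
    e ((Category.id_comp _).trans (Category.comp_id _).symm) ?_)) ?_
  · change 𝟙 _ ≫ ε = π.f 0 ≫ e.hom
    rw [hε, Category.assoc, Iso.inv_hom_id, Category.id_comp, Category.comp_id]
  · change Epi (π.f 0) ↔ Epi ε
    rw [hε]
    exact (MorphismProperty.epimorphisms A).cancel_right_of_respectsIso ε e.inv

namespace IsLeftCompleteCotorsionTheory

/-- The iterated kernels of special precovers. -/
def syz (h : IsLeftCompleteCotorsionTheory K (rightPerp K)) (M : A) : ℕ → A
  | 0 => M
  | n + 1 => h.syzygy (h.syz M n)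

/-- Splicing special precovers gives a complete resolution. -/
lemma nonempty_completeResolution (h : IsLeftCompleteCotorsionTheory K (rightPerp K)) (M : A) :
    Nonempty (CompleteResolution K M) := by
  let i (n : ℕ) : h.syz M (n + 1) ⟶ h.cover (h.syz M n) := h.syzygyι (h.syz M n)
  let p (n : ℕ) : h.cover (h.syz M n) ⟶ h.syz M n := h.coverπ (h.syz M n)
  have w (n : ℕ) : i n ≫ p n = 0 := h.syzygyι_coverπ _
  have hS (n : ℕ) : (ShortComplex.mk _ _ (w n)).ShortExact := h.shortExact_cover _
  have (n : ℕ) : Epi (p n) := (hS n).epi_g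
  have (n : ℕ) : Mono (i n) := (hS n).mono_f
  have w₀ : (splice i p w).d 1 0 ≫ p 0 = 0 :=
    (congrArg (· ≫ p 0) (splice_d i p w 0)).trans
      ((Category.assoc _ _ _).trans ((congrArg (p 1 ≫ ·) (w 0)).trans comp_zero))
  let π : splice i p w ⟶ (HomologicalComplex.single A (ComplexShape.down ℤ) 0).obj M :=
    HomologicalComplex.mkHomToSingle (j := (0 : ℤ)) (A := M) (p 0) (fun i hi => by
      obtain rfl : i = 1 := by simpa using hi.symm
      exact w₀)
  refine ⟨⟨splice i p w, ?_, isZero_splice_X i p w, π, ⟨fun n => ?_⟩, ?_⟩⟩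
  · rintro (n | n)
    · exact h.cover_mem _
    · have : IsZero ((splice i p w).X (Int.negSucc n)) :=
        isZero_splice_X i p w _ (Int.negSucc_lt_zero n)
      -- In negative degrees the term is zero, and a left orthogonal class contains the zero
      -- objects.
      have h0 := leftPerp_of_isZero (K := rightPerp K) this
      rwa [← h.left_eq] at h0
  · by_cases hn : n = 0
    · subst hn
      rw [quasiIsoAt_zero_iff (isZero_splice_X i p w _ (by simp)) π (p 0)
        (HomologicalComplex.mkHomToSingle_f _ _) w₀]
      refine ⟨?_, (hS 0).epi_g⟩
      have key := exact_epi_comp (p 1) (i 0) (p 0) (w 0) (hS 0).exact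
        (by rw [Category.assoc, w 0, comp_zero])
      exact exact_of_eq (splice_d i p w 0).symm rfl _ _ key
    · rw [quasiIsoAt_iff_exactAt' _ _ (HomologicalComplex.exactAt_single_obj _ _ _ _ hn)]
      exact splice_exactAt i p w hS n hn
  · rintro (n | n)
    -- The differential is an epimorphism onto `M (n + 1)` followed by a monomorphism, so its image
    -- is the kernel of the `n`-th special precover.
    · have : StrongEpi (p (n + 1)) := strongEpi_of_epi _
      let e := Limits.image.isoStrongEpiMono (p (n + 1)) (i n) rfl
      exact rightPerp_of_iso (e ≪≫ eqToIso (congrArg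
        (fun f : h.cover (h.syz M (n + 1)) ⟶ h.cover (h.syz M n) => Limits.image f)
        (splice_d i p w n).symm)) (h.rightPerp_syzygy _)
    · exact rightPerp_of_isZero
        (IsZero.of_mono (Limits.image.ι ((splice i p w).d (Int.negSucc n + 1) (Int.negSucc n)))
          (isZero_splice_X i p w _ (Int.negSucc_lt_zero n)))

end IsLeftCompleteCotorsionTheory

end Resolutions

/-! ### Right exactness of `T` and exactness against flat objects -/

namespace BiadditiveTHC

variable {A₁ : Type u₁} {A₂ : Type u₂} {A₃ : Type u₃}
  [Category.{v₁} A₁] [Category.{v₂} A₂] [Category.{v₃} A₃]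
  [Abelian A₁] [Abelian A₂] [Abelian A₃]
  (S : BiadditiveTHC A₁ A₂ A₃)

instance preservesColimits_left (X₂ : A₂) : PreservesColimits (S.T.flip.obj X₂) :=
  (Adjunction.ofIsLeftAdjoint (S.T.flip.obj X₂)).leftAdjoint_preservesColimits

/-- `T(X₁, -)` is right exact. -/
lemma exact_map_right (X₁ : A₁) {F : ShortComplex A₂} (hF : F.Exact) (hg : Epi F.g) :
    (F.map (S.T.obj X₁)).Exact :=
  hF.map_of_epi_of_preservesCokernel _ hg inferInstance

/-- `T(-, X₂)` is right exact. -/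
lemma exact_map_left (X₂ : A₂) {E : ShortComplex A₁} (hE : E.Exact) (hg : Epi E.g) :
    (E.map (S.T.flip.obj X₂)).Exact :=
  hE.map_of_epi_of_preservesCokernel _ hg inferInstance

/-- `T(-, X₂)` is exact if `X₂` is flat. -/
lemma flat₂.exact_map {X₂ : A₂} (h : S.flat₂ X₂) {E : ShortComplex A₁} (hE : E.Exact) :
    (E.map (S.T.flip.obj X₂)).Exact := by
  have : (S.T.flip.obj X₂).PreservesMonomorphisms := ⟨fun f _ => h f⟩
  have : PreservesFiniteLimits (S.T.flip.obj X₂) := by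
    refine ((S.T.flip.obj X₂).preservesFiniteLimits_tfae.out 0 3).1 fun E hE => ?_
    have := hE.mono_f
    exact ⟨S.exact_map_left X₂ hE.exact hE.epi_g, h _⟩
  exact hE.map _

/-! ### The snake lemma for a pair of short exact sequences -/

section Snake

variable {E : ShortComplex A₁} {F : ShortComplex A₂}

/-- The snake diagram with rows `T(E₁, F)` and `T(E₂, F)`, for short exact sequences `E` and `F`
such that `E₂` is flat. -/
def snakeInput (hE : E.ShortExact) (hP : S.flat₁ E.X₂) (hF : F.ShortExact) :
    ShortComplex.SnakeInput A₃ where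
  L₀ := kernel (F.mapNatTrans (S.T.map E.f))
  L₁ := F.map (S.T.obj E.X₁)
  L₂ := F.map (S.T.obj E.X₂)
  L₃ := F.map (S.T.obj E.X₃)
  v₀₁ := kernel.ι _
  v₁₂ := F.mapNatTrans (S.T.map E.f)
  v₂₃ := F.mapNatTrans (S.T.map E.g)
  w₀₂ := kernel.condition _
  w₁₃ := by
    have h (Y : A₂) : (S.T.map E.f).app Y ≫ (S.T.map E.g).app Y = 0 := by
      rw [← NatTrans.comp_app, ← Functor.map_comp, E.zero, Functor.map_zero, zero_app]
    ext
    exacts [h _, h _, h _]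
  h₀ := kernelIsKernel _
  h₃ := by
    have := hE.epi_g
    have (Y : A₂) : Epi (E.map (S.T.flip.obj Y)).g :=
      inferInstanceAs (Epi ((S.T.flip.obj Y).map E.g))
    have h (Y : A₂) := (S.exact_map_left Y hE.exact hE.epi_g).gIsCokernel
    exact ShortComplex.isColimitOfIsColimitπ _
      ((CokernelCofork.isColimitMapCoconeEquiv _ _).2 (h F.X₁))
      ((CokernelCofork.isColimitMapCoconeEquiv _ _).2 (h F.X₂))
      ((CokernelCofork.isColimitMapCoconeEquiv _ _).2 (h F.X₃))
  L₁_exact := S.exact_map_right _ hF.exact hF.epi_g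
  epi_L₁_g := by
    have := hF.epi_g
    exact inferInstanceAs (Epi ((S.T.obj E.X₁).map F.g))
  L₂_exact := S.exact_map_right _ hF.exact hF.epi_g
  mono_L₂_f := by
    have := hF.mono_f
    exact hP F.f

/-- If `F₃` is flat, then `T(X₁, -)` preserves the exactness of `0 ⟶ F₁ ⟶ F₂ ⟶ F₃ ⟶ 0`. -/
lemma mono_map_of_flat₂ (hE : E.ShortExact) (hP : S.flat₁ E.X₂) (hF : F.ShortExact)
    (h : S.flat₂ F.X₃) : Mono ((S.T.obj E.X₃).map F.f) := by
  let D := S.snakeInput hE hP hF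
  have := hE.mono_f
  -- Flatness of `F₃` kills the third term of the kernel row, which is the source of the connecting
  -- morphism; exactness after it gives injectivity.
  have : Mono D.v₁₂.τ₃ := h E.f
  have h₀ : IsZero D.L₀.X₃ := by
    have : D.v₀₁.τ₃ = 0 := zero_of_comp_mono D.v₁₂.τ₃ D.w₀₂_τ₃
    exact IsZero.of_mono_eq_zero _ this
  exact (D.L₂'.exact_iff_mono (h₀.eq_zero_of_src _)).1 D.L₂'_exact

/-- If `F₂` is flat, the connecting morphism identifies `ker (T(E₁, F₃) ⟶ T(E₂, F₃))` and
`ker (T(E₃, F₁) ⟶ T(E₃, F₂))`. -/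
lemma nonempty_kernel_iso (hE : E.ShortExact) (hP : S.flat₁ E.X₂) (hF : F.ShortExact)
    (h : S.flat₂ F.X₂) :
    Nonempty (kernel ((S.T.map E.f).app F.X₃) ≅ kernel ((S.T.obj E.X₃).map F.f)) := by
  let D := S.snakeInput hE hP hF
  have := hE.mono_f
  have : Mono D.v₁₂.τ₂ := h E.f
  have h₀ : IsZero D.L₀.X₂ := by
    have : D.v₀₁.τ₂ = 0 := zero_of_comp_mono D.v₁₂.τ₂ D.w₀₂_τ₂
    exact IsZero.of_mono_eq_zero _ this
  -- The kernel row vanishes in the middle, so the connecting morphism is a monomorphism; by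
  -- exactness it is then the kernel of `T(E₃, F₁) ⟶ T(E₃, F₂)`.
  have : Mono D.L₂'.f := D.mono_δ h₀
  have : Mono (ShortComplex.mk _ _ D.w₀₂_τ₃).f := inferInstanceAs (Mono D.v₀₁.τ₃)
  let e₁ := (kernelIsKernel D.v₁₂.τ₃).conePointUniqueUpToIso D.exact_C₃_up.fIsKernel
  let e₂ := D.L₂'_exact.fIsKernel.conePointUniqueUpToIso (kernelIsKernel D.L₃.f)
  exact ⟨e₁ ≪≫ e₂⟩

end Snake


variable {A₁ : Type u₁} {A₂ : Type u₂} {A₃ : Type u₃}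
  [Category.{v₁} A₁] [Category.{v₂} A₂] [Category.{v₃} A₃]
  [Abelian A₁] [Abelian A₂] [Abelian A₃]
  (S : BiadditiveTHC A₁ A₂ A₃)

lemma map_app_comp_map_app {X Y Z : A₁} {f : X ⟶ Y} {g : Y ⟶ Z} (w : f ≫ g = 0) (X₂ : A₂) :
    (S.T.map f).app X₂ ≫ (S.T.map g).app X₂ = 0 := by
  rw [← NatTrans.comp_app, ← Functor.map_comp, w, Functor.map_zero, zero_app]

lemma exact_map_app_up_to_refinements {X Y Z : A₁} {f : X ⟶ Y} {g : Y ⟶ Z} {w : f ≫ g = 0}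
    (h : (ShortComplex.mk f g w).Exact) [hg : Epi g] {X₂ : A₂} {B : A₃}
    (x : B ⟶ (S.T.obj Y).obj X₂) (hx : x ≫ (S.T.map g).app X₂ = 0) :
    ∃ (B' : A₃) (π : B' ⟶ B) (_ : Epi π) (y : B' ⟶ (S.T.obj X).obj X₂),
      π ≫ x = y ≫ (S.T.map f).app X₂ :=
  (S.exact_map_left X₂ h hg).exact_up_to_refinements x hx

lemma exact_obj_map_up_to_refinements {X Y Z : A₂} {f : X ⟶ Y} {g : Y ⟶ Z} {w : f ≫ g = 0}
    (h : (ShortComplex.mk f g w).Exact) [hg : Epi g] {X₁ : A₁} {B : A₃}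
    (x : B ⟶ (S.T.obj X₁).obj Y) (hx : x ≫ (S.T.obj X₁).map g = 0) :
    ∃ (B' : A₃) (π : B' ⟶ B) (_ : Epi π) (y : B' ⟶ (S.T.obj X₁).obj X),
      π ≫ x = y ≫ (S.T.obj X₁).map f :=
  (S.exact_map_right X₁ h hg).exact_up_to_refinements x hx

lemma flat₂.exact_map_app_up_to_refinements {X₂ : A₂} (hX₂ : S.flat₂ X₂) {X Y Z : A₁}
    {f : X ⟶ Y} {g : Y ⟶ Z} {w : f ≫ g = 0} (h : (ShortComplex.mk f g w).Exact) {B : A₃}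
    (x : B ⟶ (S.T.obj Y).obj X₂) (hx : x ≫ (S.T.map g).app X₂ = 0) :
    ∃ (B' : A₃) (π : B' ⟶ B) (_ : Epi π) (y : B' ⟶ (S.T.obj X).obj X₂),
      π ≫ x = y ≫ (S.T.map f).app X₂ :=
  (hX₂.exact_map S h).exact_up_to_refinements x hx

lemma isZero_obj_obj_of_left {X₁ : A₁} (h : IsZero X₁) (X₂ : A₂) :
    IsZero ((S.T.obj X₁).obj X₂) :=
  (S.T.flip.obj X₂).map_isZero h

lemma isZero_obj_obj_of_right (X₁ : A₁) {X₂ : A₂} (h : IsZero X₂) :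
    IsZero ((S.T.obj X₁).obj X₂) :=
  (S.T.obj X₁).map_isZero h

/-! ### The first homology of the tensor product of two nonnegative complexes -/

variable [HasColimits A₃] (C₁ : ChainComplex A₁ ℤ) (C₂ : ChainComplex A₂ ℤ)

variable {C₁ C₂} in
lemma tensor_hom_ext {n : ℤ} {Y : A₃} {f g : (S.tensor C₁ C₂).X n ⟶ Y}
    (h : ∀ (p q : ℤ) (h : p + q = n), S.ι C₁ C₂ p q n h ≫ f = S.ι C₁ C₂ p q n h ≫ g) : f = g :=
  HomologicalComplex.mapBifunctor.hom_ext h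

/-- The projection to the summand of bidegree `(p, q)`. -/
def ρ (p q n : ℤ) (h : p + q = n) :
    (S.tensor C₁ C₂).X n ⟶ (S.T.obj (C₁.X p)).obj (C₂.X q) :=
  HomologicalComplex.mapBifunctorDesc (fun p' q' h' =>
    if hp : p' = p then eqToHom (by
      have h'' : p' + q' = n := h'
      obtain rfl : q' = q := by lia
      rw [hp]) else 0)

@[simp]
lemma ι_ρ (p q n : ℤ) (h : p + q = n) :
    S.ι C₁ C₂ p q n h ≫ S.ρ C₁ C₂ p q n h = 𝟙 _ :=
  (HomologicalComplex.ι_mapBifunctorDesc _ p q h).trans (dif_pos rfl)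

lemma ι_ρ_assoc (p q n : ℤ) (h : p + q = n) {Y : A₃} (f : _ ⟶ Y) :
    S.ι C₁ C₂ p q n h ≫ S.ρ C₁ C₂ p q n h ≫ f = f := by
  rw [reassoc_of% (S.ι_ρ C₁ C₂ p q n h)]

lemma ι_ρ_of_ne (p q p' q' n : ℤ) (h : p + q = n) (h' : p' + q' = n) (hp : p' ≠ p) :
    S.ι C₁ C₂ p' q' n h' ≫ S.ρ C₁ C₂ p q n h = 0 :=
  (HomologicalComplex.ι_mapBifunctorDesc _ p' q' h').trans (dif_neg hp)

lemma ι_ρ_of_ne_assoc (p q p' q' n : ℤ) (h : p + q = n) (h' : p' + q' = n) (hp : p' ≠ p)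
    {Y : A₃} (f : _ ⟶ Y) : S.ι C₁ C₂ p' q' n h' ≫ S.ρ C₁ C₂ p q n h ≫ f = 0 ≫ f := by
  rw [reassoc_of% (S.ι_ρ_of_ne C₁ C₂ p q p' q' n h h' hp), zero_comp]

section

variable {C₁ C₂}

lemma ι_eq_zero_of_neg (hC₁ : ∀ n < 0, IsZero (C₁.X n)) (hC₂ : ∀ n < 0, IsZero (C₂.X n))
    (p q n : ℤ) (h : p + q = n) (hpq : p < 0 ∨ q < 0) : S.ι C₁ C₂ p q n h = 0 := by
  obtain hp | hq := hpq
  · exact (S.isZero_obj_obj_of_left (hC₁ p hp) _).eq_of_src _ _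
  · exact (S.isZero_obj_obj_of_right _ (hC₂ q hq)).eq_of_src _ _

lemma ρ_ι_one (hC₁ : ∀ n < 0, IsZero (C₁.X n)) (hC₂ : ∀ n < 0, IsZero (C₂.X n)) :
    S.ρ C₁ C₂ 1 0 1 rfl ≫ S.ι C₁ C₂ 1 0 1 rfl +
      S.ρ C₁ C₂ 0 1 1 rfl ≫ S.ι C₁ C₂ 0 1 1 rfl = 𝟙 _ := by
  refine S.tensor_hom_ext fun p q h => ?_
  by_cases hpq : p < 0 ∨ q < 0
  · simp only [S.ι_eq_zero_of_neg hC₁ hC₂ p q 1 h hpq, zero_comp]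
  · rw [Preadditive.comp_add, Category.comp_id]
    obtain ⟨rfl, rfl⟩ | ⟨rfl, rfl⟩ : (p = 1 ∧ q = 0) ∨ (p = 0 ∧ q = 1) := by lia
    · rw [ι_ρ_assoc, S.ι_ρ_of_ne_assoc _ _ _ _ _ _ _ _ _ (by simp), zero_comp, add_zero]
    · rw [ι_ρ_assoc, S.ι_ρ_of_ne_assoc _ _ _ _ _ _ _ _ _ (by simp), zero_comp, zero_add]

lemma ι_d_one_zero (hC₁ : ∀ n < 0, IsZero (C₁.X n)) (hC₂ : ∀ n < 0, IsZero (C₂.X n)) :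
    S.ι C₁ C₂ 1 0 1 rfl ≫ (S.tensor C₁ C₂).d 1 0 =
      (S.T.map (C₁.d 1 0)).app (C₂.X 0) ≫ S.ι C₁ C₂ 0 0 0 rfl := by
  rw [S.ι_d C₁ C₂ 1 0 1 0 (-1) 0 rfl rfl rfl rfl,
    S.ι_eq_zero_of_neg hC₁ hC₂ 1 (-1) 0 _ (by simp), comp_zero, smul_zero, add_zero]

lemma ι_d_zero_one (hC₁ : ∀ n < 0, IsZero (C₁.X n)) (hC₂ : ∀ n < 0, IsZero (C₂.X n)) :
    S.ι C₁ C₂ 0 1 1 rfl ≫ (S.tensor C₁ C₂).d 1 0 =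
      (S.T.obj (C₁.X 0)).map (C₂.d 1 0) ≫ S.ι C₁ C₂ 0 0 0 rfl := by
  rw [S.ι_d C₁ C₂ 0 1 1 (-1) 0 0 rfl rfl rfl rfl,
    S.ι_eq_zero_of_neg hC₁ hC₂ (-1) 1 0 _ (by simp), comp_zero, zero_add, Int.negOnePow_zero,
    one_smul]

lemma ι_d_two_zero (hC₁ : ∀ n < 0, IsZero (C₁.X n)) (hC₂ : ∀ n < 0, IsZero (C₂.X n)) :
    S.ι C₁ C₂ 2 0 2 rfl ≫ (S.tensor C₁ C₂).d 2 1 =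
      (S.T.map (C₁.d 2 1)).app (C₂.X 0) ≫ S.ι C₁ C₂ 1 0 1 rfl := by
  rw [S.ι_d C₁ C₂ 2 0 2 1 (-1) 1 rfl rfl rfl rfl,
    S.ι_eq_zero_of_neg hC₁ hC₂ 2 (-1) 1 _ (by simp), comp_zero, smul_zero, add_zero]

lemma ι_d_one_one : S.ι C₁ C₂ 1 1 2 rfl ≫ (S.tensor C₁ C₂).d 2 1 =
    (S.T.map (C₁.d 1 0)).app (C₂.X 1) ≫ S.ι C₁ C₂ 0 1 1 rfl -
      (S.T.obj (C₁.X 1)).map (C₂.d 1 0) ≫ S.ι C₁ C₂ 1 0 1 rfl := by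
  rw [S.ι_d C₁ C₂ 1 1 2 0 0 1 rfl rfl rfl rfl, Int.negOnePow_one, Units.neg_smul, one_smul,
    sub_eq_add_neg]

lemma ι_d_zero_two (hC₁ : ∀ n < 0, IsZero (C₁.X n)) (hC₂ : ∀ n < 0, IsZero (C₂.X n)) :
    S.ι C₁ C₂ 0 2 2 rfl ≫ (S.tensor C₁ C₂).d 2 1 =
      (S.T.obj (C₁.X 0)).map (C₂.d 2 1) ≫ S.ι C₁ C₂ 0 1 1 rfl := by
  rw [S.ι_d C₁ C₂ 0 2 2 (-1) 1 1 rfl rfl rfl rfl,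
    S.ι_eq_zero_of_neg hC₁ hC₂ (-1) 2 1 _ (by simp), comp_zero, zero_add, Int.negOnePow_zero,
    one_smul]

lemma d_one_zero_eq (hC₁ : ∀ n < 0, IsZero (C₁.X n)) (hC₂ : ∀ n < 0, IsZero (C₂.X n)) :
    (S.tensor C₁ C₂).d 1 0 = (S.ρ C₁ C₂ 1 0 1 rfl ≫ (S.T.map (C₁.d 1 0)).app (C₂.X 0) +
      S.ρ C₁ C₂ 0 1 1 rfl ≫ (S.T.obj (C₁.X 0)).map (C₂.d 1 0)) ≫ S.ι C₁ C₂ 0 0 0 rfl := by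
  rw [← Category.id_comp ((S.tensor C₁ C₂).d 1 0), ← S.ρ_ι_one hC₁ hC₂, Preadditive.add_comp,
    Category.assoc, Category.assoc, S.ι_d_one_zero hC₁ hC₂, S.ι_d_zero_one hC₁ hC₂,
    Preadditive.add_comp, Category.assoc, Category.assoc]

/-- In total degree `1` only the bidegrees `(1, 0)` and `(0, 1)` contribute, and both land in the
summand `(0, 0)`, which `ρ` splits off. -/
lemma comp_d_one_zero_eq_zero_iff (hC₁ : ∀ n < 0, IsZero (C₁.X n))
    (hC₂ : ∀ n < 0, IsZero (C₂.X n)) {B : A₃} (z : B ⟶ (S.tensor C₁ C₂).X 1) :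
    z ≫ (S.tensor C₁ C₂).d 1 0 = 0 ↔
      z ≫ S.ρ C₁ C₂ 1 0 1 rfl ≫ (S.T.map (C₁.d 1 0)).app (C₂.X 0) +
        z ≫ S.ρ C₁ C₂ 0 1 1 rfl ≫ (S.T.obj (C₁.X 0)).map (C₂.d 1 0) = 0 := by
  rw [S.d_one_zero_eq hC₁ hC₂, ← Category.assoc, Preadditive.comp_add]
  constructor
  · intro h
    simpa using h =≫ S.ρ C₁ C₂ 0 0 0 rfl
  · intro h
    rw [h, zero_comp]

variable {X : A₁} (ε : C₁.X 0 ⟶ X) {K : A₂} (e : C₂.X 1 ⟶ K) (k : K ⟶ C₂.X 0)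

/-- The morphism `T(C₁, C₂)_1 ⟶ T(X, K)` induced by morphisms from `(C₁)_0` to `X` and
from `(C₂)_1` to `K`. -/
def toHomologyOne : (S.tensor C₁ C₂).X 1 ⟶ (S.T.obj X).obj K :=
  S.ρ C₁ C₂ 0 1 1 rfl ≫ (S.T.map ε).app (C₂.X 1) ≫ (S.T.obj X).map e

lemma d_toHomologyOne (hε : C₁.d 1 0 ≫ ε = 0) (he : C₂.d 2 1 ≫ e = 0) :
    (S.tensor C₁ C₂).d 2 1 ≫ S.toHomologyOne ε e = 0 := by
  refine S.tensor_hom_ext fun p q h => ?_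
  obtain ⟨p', hp'⟩ : ∃ p', p' + 1 = p := ⟨p - 1, by lia⟩
  obtain ⟨q', hq'⟩ : ∃ q', q' + 1 = q := ⟨q - 1, by lia⟩
  rw [comp_zero, ← Category.assoc, S.ι_d C₁ C₂ p q 2 p' q' 1 h hp' hq' rfl,
    Preadditive.add_comp, Linear.units_smul_comp, Category.assoc, Category.assoc, toHomologyOne]
  -- Only the bidegrees `(0, 2)` and `(1, 1)` have a differential reaching `(0, 1)`; the first is
  -- killed by `e`, the second by `ε`.
  by_cases hp : p = 0
  · obtain rfl : q = 2 := by lia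
    obtain rfl : q' = 1 := by lia
    subst hp
    rw [S.ι_ρ_of_ne_assoc _ _ _ _ _ _ _ _ _ (by lia), zero_comp, comp_zero, zero_add,
      S.ι_ρ_assoc, NatTrans.naturality_assoc, ← Functor.map_comp, he,
      Functor.map_zero, comp_zero, smul_zero]
  · rw [S.ι_ρ_of_ne_assoc _ _ _ _ _ _ _ _ _ hp, zero_comp, comp_zero, smul_zero, add_zero]
    by_cases hp₁ : p = 1
    · obtain rfl : q = 1 := by lia
      obtain rfl : p' = 0 := by lia
      subst hp₁
      rw [S.ι_ρ_assoc, reassoc_of% (S.map_app_comp_map_app hε (C₂.X 1)), zero_comp]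
    · rw [S.ι_ρ_of_ne_assoc _ _ _ _ _ _ _ _ _ (by lia), zero_comp, comp_zero]

/-- For a cycle, the images of the two components in `T((C₁)_0, (C₂)_0)` cancel. The one from `(1,
0)` becomes zero in `T(X, (C₂)_0)`, hence so does the one from `(0, 1)`. -/
lemma iCycles_toHomologyOne (hC₁ : ∀ n < 0, IsZero (C₁.X n)) (hC₂ : ∀ n < 0, IsZero (C₂.X n))
    (hε : C₁.d 1 0 ≫ ε = 0) (hek : e ≫ k = C₂.d 1 0) :
    ((S.tensor C₁ C₂).iCycles 1 ≫ S.toHomologyOne ε e) ≫ (S.T.obj X).map k = 0 := by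
  have h := (S.comp_d_one_zero_eq_zero_iff hC₁ hC₂ ((S.tensor C₁ C₂).iCycles 1)).1
    (HomologicalComplex.iCycles_d _ _ _)
  rw [toHomologyOne, Category.assoc, Category.assoc, Category.assoc, ← Functor.map_comp, hek,
    ← NatTrans.naturality]
  have h' := h =≫ (S.T.map ε).app (C₂.X 0)
  simpa only [Preadditive.add_comp, Category.assoc, S.map_app_comp_map_app hε, comp_zero,
    zero_add, zero_comp] using h'

/-- The morphism from the cycles of `T(C₁, C₂)` in degree `1` to the kernel of
`T(X, K) ⟶ T(X, (C₂)_0)`. -/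
def cyclesToKernel (hC₁ : ∀ n < 0, IsZero (C₁.X n)) (hC₂ : ∀ n < 0, IsZero (C₂.X n))
    (hε : C₁.d 1 0 ≫ ε = 0) (hek : e ≫ k = C₂.d 1 0) :
    (S.tensor C₁ C₂).cycles 1 ⟶ kernel ((S.T.obj X).map k) :=
  kernel.lift _ _ (S.iCycles_toHomologyOne ε e k hC₁ hC₂ hε hek)

/-- A zigzag in the double complex: lift an element of the kernel to `T((C₁)_0, (C₂)_1)`, then
correct it in bidegree `(1, 0)` to obtain a cycle. Right exactness of `T` suffices. -/
lemma epi_cyclesToKernel (hC₁ : ∀ n < 0, IsZero (C₁.X n)) (hC₂ : ∀ n < 0, IsZero (C₂.X n))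
    (hε : C₁.d 1 0 ≫ ε = 0) (hε' : (ShortComplex.mk _ _ hε).Exact) [Epi ε]
    (hek : e ≫ k = C₂.d 1 0) [Epi e] :
    Epi (S.cyclesToKernel ε e k hC₁ hC₂ hε hek) := by
  rw [epi_iff_surjective_up_to_refinements]
  intro B x
  obtain ⟨B₁, π₁, _, b, hb⟩ := surjective_up_to_refinements_of_epi
    ((S.T.map ε).app (C₂.X 1) ≫ (S.T.obj X).map e) (x ≫ kernel.ι _)
  have h₀ : (b ≫ (S.T.obj (C₁.X 0)).map (C₂.d 1 0)) ≫ (S.T.map ε).app (C₂.X 0) = 0 := by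
    have h := hb =≫ (S.T.obj X).map k
    simp only [Category.assoc, kernel.condition, comp_zero] at h
    rw [← Functor.map_comp, hek, ← NatTrans.naturality] at h
    rw [Category.assoc, ← h]
  obtain ⟨B₂, π₂, _, a, ha⟩ := S.exact_map_app_up_to_refinements hε' _ h₀
  let z : B₂ ⟶ (S.tensor C₁ C₂).X 1 :=
    (π₂ ≫ b) ≫ S.ι C₁ C₂ 0 1 1 rfl - a ≫ S.ι C₁ C₂ 1 0 1 rfl
  have hz : z ≫ (S.tensor C₁ C₂).d 1 0 = 0 := by
    dsimp only [z]
    rw [Preadditive.sub_comp, Category.assoc, Category.assoc, Category.assoc,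
      S.ι_d_one_zero hC₁ hC₂, S.ι_d_zero_one hC₁ hC₂, reassoc_of% ha, sub_self]
  refine ⟨B₂, π₂ ≫ π₁, inferInstance, (S.tensor C₁ C₂).liftCycles z 0 (by simp) hz, ?_⟩
  rw [← cancel_mono (kernel.ι _), Category.assoc, Category.assoc, cyclesToKernel,
    Category.assoc, kernel.lift_ι, HomologicalComplex.liftCycles_i_assoc, hb, toHomologyOne]
  dsimp only [z]
  rw [Preadditive.sub_comp, Category.assoc, Category.assoc, Category.assoc, ι_ρ_assoc,
    S.ι_ρ_of_ne_assoc _ _ _ _ _ _ _ _ _ (by simp), zero_comp, comp_zero, sub_zero]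

lemma toCycles_cyclesToKernel (hC₁ : ∀ n < 0, IsZero (C₁.X n))
    (hC₂ : ∀ n < 0, IsZero (C₂.X n)) (hε : C₁.d 1 0 ≫ ε = 0)
    (hek : e ≫ k = C₂.d 1 0) (he : C₂.d 2 1 ≫ e = 0) :
    (S.tensor C₁ C₂).toCycles 2 1 ≫ S.cyclesToKernel ε e k hC₁ hC₂ hε hek = 0 := by
  rw [← cancel_mono (kernel.ι _), Category.assoc, cyclesToKernel, kernel.lift_ι, zero_comp,
    HomologicalComplex.toCycles_i_assoc, S.d_toHomologyOne ε e hε he]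

/-- Subtracting boundaries from bidegrees `(1, 1)` and `(0, 2)` removes the `(0, 1)` component of
the cycle. The remaining `(1, 0)` component is a cycle of `T(C₁, (C₂)_0)`, hence a boundary, since
`(C₂)_0` is flat and `C₁` is exact in degree `1`. -/
lemma exact_cyclesToKernel (hC₁ : ∀ n < 0, IsZero (C₁.X n)) (hC₂ : ∀ n < 0, IsZero (C₂.X n))
    (hε : C₁.d 1 0 ≫ ε = 0) (hε' : (ShortComplex.mk _ _ hε).Exact) [Epi ε]
    (hek : e ≫ k = C₂.d 1 0) [Epi e] (he : C₂.d 2 1 ≫ e = 0)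
    (he' : (ShortComplex.mk _ _ he).Exact)
    (hC₁' : (ShortComplex.mk (C₁.d 2 1) (C₁.d 1 0) (by simp)).Exact)
    (hflat : S.flat₂ (C₂.X 0)) :
    (ShortComplex.mk _ _ (S.toCycles_cyclesToKernel ε e k hC₁ hC₂ hε hek he)).Exact := by
  rw [ShortComplex.exact_iff_exact_up_to_refinements]
  intro B (x : B ⟶ (S.tensor C₁ C₂).cycles 1) hx
  replace hx : x ≫ S.cyclesToKernel ε e k hC₁ hC₂ hε hek = 0 := hx
  have hx' : ((x ≫ (S.tensor C₁ C₂).iCycles 1) ≫ S.ρ C₁ C₂ 0 1 1 rfl ≫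
      (S.T.obj (C₁.X 0)).map e) ≫ (S.T.map ε).app K = 0 := by
    have h := hx =≫ kernel.ι _
    rw [Category.assoc, cyclesToKernel, kernel.lift_ι, zero_comp, toHomologyOne,
      ← NatTrans.naturality] at h
    simpa only [Category.assoc] using h
  obtain ⟨B₁, π₁, _, y, hy⟩ := S.exact_map_app_up_to_refinements hε' _ hx'
  -- The part of the `(0, 1)` component visible in `T((C₁)_0, K)` comes from `(1, 1)` through `c`;
  -- what is left dies under `e` and so comes from `(0, 2)` through `w`.
  obtain ⟨B₂, π₂, _, c, hc⟩ := surjective_up_to_refinements_of_epi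
    ((S.T.obj (C₁.X 1)).map e) y
  let b : B₂ ⟶ _ := (π₂ ≫ π₁ ≫ x ≫ (S.tensor C₁ C₂).iCycles 1) ≫ S.ρ C₁ C₂ 0 1 1 rfl -
    c ≫ (S.T.map (C₁.d 1 0)).app (C₂.X 1)
  have hb : b ≫ (S.T.obj (C₁.X 0)).map e = 0 := by
    dsimp only [b]
    rw [Preadditive.sub_comp, Category.assoc c, ← NatTrans.naturality, ← reassoc_of% hc, ← hy]
    simp only [Category.assoc, sub_self]
  obtain ⟨B₃, π₃, _, w, hw⟩ := S.exact_obj_map_up_to_refinements he' _ hb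
  let z : B₃ ⟶ (S.tensor C₁ C₂).X 1 := (π₃ ≫ π₂ ≫ π₁ ≫ x ≫ (S.tensor C₁ C₂).iCycles 1) -
    ((π₃ ≫ c) ≫ S.ι C₁ C₂ 1 1 2 rfl + w ≫ S.ι C₁ C₂ 0 2 2 rfl) ≫ (S.tensor C₁ C₂).d 2 1
  have hz : z ≫ (S.tensor C₁ C₂).d 1 0 = 0 := by
    simp [z, Preadditive.sub_comp]
  have hz₀ : z ≫ S.ρ C₁ C₂ 0 1 1 rfl = 0 := by
    dsimp only [z, b] at hw ⊢
    rw [Preadditive.add_comp, Category.assoc, Category.assoc, Category.assoc w, S.ι_d_one_one,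
      S.ι_d_zero_two hC₁ hC₂, Preadditive.comp_sub, Preadditive.sub_comp, Preadditive.add_comp]
    simp only [Preadditive.sub_comp, Preadditive.comp_sub, Category.assoc, S.ι_ρ,
      S.ι_ρ_of_ne C₁ C₂ 0 1 1 0 1 rfl rfl (by simp), comp_zero,
      sub_zero, Category.comp_id]
    rw [← hw, Preadditive.comp_sub]
    simp only [Category.assoc]
    abel
  have hz₁ : (z ≫ S.ρ C₁ C₂ 1 0 1 rfl) ≫ (S.T.map (C₁.d 1 0)).app (C₂.X 0) = 0 := by
    have h := (S.comp_d_one_zero_eq_zero_iff hC₁ hC₂ z).1 hz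
    rwa [reassoc_of% hz₀, zero_comp, add_zero, ← Category.assoc] at h
  have hz₂ : z = (z ≫ S.ρ C₁ C₂ 1 0 1 rfl) ≫ S.ι C₁ C₂ 1 0 1 rfl := by
    have h := z ≫= S.ρ_ι_one hC₁ hC₂
    rw [Preadditive.comp_add, reassoc_of% hz₀, zero_comp, add_zero, Category.comp_id] at h
    rw [Category.assoc, h]
  obtain ⟨B₄, π₄, _, v, hv⟩ := hflat.exact_map_app_up_to_refinements S hC₁' _ hz₁
  refine ⟨B₄, π₄ ≫ π₃ ≫ π₂ ≫ π₁, inferInstance, v ≫ S.ι C₁ C₂ 2 0 2 rfl +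
    π₄ ≫ ((π₃ ≫ c) ≫ S.ι C₁ C₂ 1 1 2 rfl + w ≫ S.ι C₁ C₂ 0 2 2 rfl), ?_⟩
  rw [← cancel_mono ((S.tensor C₁ C₂).iCycles 1)]
  dsimp only
  rw [Category.assoc, Category.assoc _ _ ((S.tensor C₁ C₂).iCycles 1),
    HomologicalComplex.toCycles_i,
    Preadditive.add_comp _ _ _ _ _ ((S.tensor C₁ C₂).d 2 1), Category.assoc v,
    S.ι_d_two_zero hC₁ hC₂, ← reassoc_of% hv, Category.assoc π₄ _ ((S.tensor C₁ C₂).d 2 1),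
    ← Preadditive.comp_add]
  rw [Category.assoc] at hz₂
  rw [← hz₂]
  simp [z]

/-- The homology in degree `1` of the tensor product of two complexes in nonnegative degrees. -/
lemma nonempty_homology_one_iso (hC₁ : ∀ n < 0, IsZero (C₁.X n))
    (hC₂ : ∀ n < 0, IsZero (C₂.X n))
    (hε : C₁.d 1 0 ≫ ε = 0) (hε' : (ShortComplex.mk _ _ hε).Exact) [Epi ε]
    (hek : e ≫ k = C₂.d 1 0) [Epi e] (he : C₂.d 2 1 ≫ e = 0)
    (he' : (ShortComplex.mk _ _ he).Exact)
    (hC₁' : (ShortComplex.mk (C₁.d 2 1) (C₁.d 1 0) (by simp)).Exact)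
    (hflat : S.flat₂ (C₂.X 0)) :
    Nonempty ((S.tensor C₁ C₂).homology 1 ≅ kernel ((S.T.obj X).map k)) := by
  have h := S.exact_cyclesToKernel ε e k hC₁ hC₂ hε hε' hek he he' hC₁' hflat
  have : Epi (ShortComplex.mk _ _
    (S.toCycles_cyclesToKernel ε e k hC₁ hC₂ hε hek he)).g :=
    S.epi_cyclesToKernel ε e k hC₁ hC₂ hε hε' hek
  exact ⟨((S.tensor C₁ C₂).homologyIsCokernel 2 1 (by simp)).coconePointUniqueUpToIso
    h.gIsCokernel⟩

end

end BiadditiveTHC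

/-! ### The augmentation and first syzygy of a complete resolution -/

namespace CompleteResolution

variable {A : Type u} [Category.{v} A] [Abelian A] {K : ObjectProperty A} {M : A}
  (R : CompleteResolution K M)

/-- The augmentation of a complete resolution. -/
def ε : R.complex.X 0 ⟶ M :=
  R.π.f 0 ≫ (HomologicalComplex.singleObjXSelf (ComplexShape.down ℤ) 0 M).hom

lemma d_ε : R.complex.d 1 0 ≫ R.ε = 0 := by
  have h : R.complex.d 1 0 ≫ R.π.f 0 = 0 := by
    rw [← R.π.comm 1 0]
    exact (congrArg (R.π.f 1 ≫ ·)
      (HomologicalComplex.single_obj_d (ComplexShape.down ℤ) _ _ _ _)).trans comp_zero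
  rw [ε, reassoc_of% h, zero_comp]

lemma exact_and_epi_ε : (ShortComplex.mk _ _ R.d_ε).Exact ∧ Epi R.ε := by
  have := R.quasiIso
  refine (quasiIsoAt_zero_iff (R.isZero _ (by simp)) R.π R.ε ?_ R.d_ε).1 inferInstance
  rw [ε, Category.assoc, Iso.hom_inv_id, Category.comp_id]

lemma exact_ε : (ShortComplex.mk _ _ R.d_ε).Exact := R.exact_and_epi_ε.1

instance : Epi R.ε := R.exact_and_epi_ε.2

lemma exact_d_d : (ShortComplex.mk (R.complex.d 2 1) (R.complex.d 1 0) (by simp)).Exact := by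
  have := R.quasiIso
  have h : R.complex.ExactAt 1 := (exactAt_iff_of_quasiIsoAt R.π 1).2
    (HomologicalComplex.exactAt_single_obj _ _ _ _ (by simp))
  exact (R.complex.exactAt_iff' 2 1 0 (by simp) (by simp)).1 h

lemma d_kernelLift : R.complex.d 2 1 ≫ kernel.lift R.ε (R.complex.d 1 0) R.d_ε = 0 := by
  rw [← cancel_mono (kernel.ι R.ε), Category.assoc, kernel.lift_ι, zero_comp,
    HomologicalComplex.d_comp_d]

/-- The kernel of the augmentation embeds in degree `0`, so this is exactness of the resolution in
degree `1`. -/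
lemma exact_kernelLift : (ShortComplex.mk _ _ R.d_kernelLift).Exact := by
  let φ : ShortComplex.mk _ _ R.d_kernelLift ⟶
      ShortComplex.mk (R.complex.d 2 1) (R.complex.d 1 0) (by simp) :=
    { τ₁ := 𝟙 _, τ₂ := 𝟙 _, τ₃ := kernel.ι _ }
  have : Epi φ.τ₁ := inferInstanceAs (Epi (𝟙 _))
  have : IsIso φ.τ₂ := inferInstanceAs (IsIso (𝟙 _))
  have : Mono φ.τ₃ := inferInstanceAs (Mono (kernel.ι _))
  exact (ShortComplex.exact_iff_of_epi_of_isIso_of_mono φ).2 R.exact_d_d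

instance : Epi (kernel.lift R.ε (R.complex.d 1 0) R.d_ε) :=
  (ShortComplex.exact_iff_epi_kernel_lift _).1 R.exact_ε

end CompleteResolution

/-! ### Balancing of `Tor₁` -/

namespace BiadditiveTHC

variable {A₁ : Type u₁} {A₂ : Type u₂} {A₃ : Type u₃}
  [Category.{v₁} A₁] [Category.{v₂} A₂] [Category.{v₃} A₃]
  [Abelian A₁] [Abelian A₂] [Abelian A₃]
  (S : BiadditiveTHC A₁ A₂ A₃)

lemma shortExact_kernel {A : Type u} [Category.{v} A] [Abelian A] {X Y : A} (f : X ⟶ Y) [Epi f] :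
    (ShortComplex.mk (kernel.ι f) f (kernel.condition f)).ShortExact where
  exact := ShortComplex.exact_kernel f

/-- Balancing: `Tor₁(X₁, F₃)` is the kernel of `T(X₁, F₁) ⟶ T(X₁, F₂)` for any short exact
sequence `F` such that `F₂` is flat. -/
lemma nonempty_tor_one_iso [HasColimits A₃]
    (h₁ : IsLeftCompleteCotorsionTheory S.flat₁ (rightPerp S.flat₁))
    {X₁ : A₁} {F : ShortComplex A₂} (hF : F.ShortExact) (hF₂ : S.flat₂ F.X₂)
    (R₁ : CompleteResolution S.flat₁ X₁) (R₂ : CompleteResolution S.flat₂ F.X₃) :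
    Nonempty (S.tor R₁ R₂ 1 ≅ kernel ((S.T.obj X₁).map F.f)) := by
  obtain ⟨e₁⟩ := S.nonempty_homology_one_iso R₁.ε (kernel.lift R₂.ε (R₂.complex.d 1 0) R₂.d_ε)
    (kernel.ι R₂.ε) R₁.isZero R₂.isZero R₁.d_ε R₁.exact_ε (kernel.lift_ι _ _ _) R₂.d_kernelLift
    R₂.exact_kernelLift R₁.exact_d_d (R₂.mem 0)
  have hE := h₁.shortExact_cover X₁
  -- Both presentations of `F₃`, the one from `R₂` and `F` itself, are compared with the kernel of
  -- `T(E₁, F₃) ⟶ T(E₂, F₃)` for the same flat cover `E` of `X₁`.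
  obtain ⟨e₂⟩ := S.nonempty_kernel_iso hE (h₁.cover_mem X₁) (shortExact_kernel R₂.ε) (R₂.mem 0)
  obtain ⟨e₃⟩ := S.nonempty_kernel_iso hE (h₁.cover_mem X₁) hF hF₂
  exact ⟨e₁ ≪≫ e₂.symm ≪≫ e₃⟩


variable {A₁ : Type u₁} {A₂ : Type u₂} {A₃ : Type u₃}
  [Category.{v₁} A₁] [Category.{v₂} A₂] [Category.{v₃} A₃]
  [Abelian A₁] [Abelian A₂] [Abelian A₃]
  (S : BiadditiveTHC A₁ A₂ A₃)

/-! ### Cycles and homology of `T(C₁, G)` for a graded family `G` -/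

section

variable [HasColimits A₃] (C₁ : ChainComplex A₁ ℤ) (C₂ : ChainComplex A₂ ℤ)

/-- The degree `n` term of `T(C₁, C₂)` as a coproduct. -/
def isColimitTensor {J : Type} (n : ℤ) (p q : J → ℤ) (hpq : ∀ j, p j + q j = n)
    (hq : Function.Bijective q) :
    IsColimit (Cofan.mk ((S.tensor C₁ C₂).X n)
      (fun j => S.ι C₁ C₂ (p j) (q j) n (hpq j))) :=
  Cofan.IsColimit.mk _
    (fun s => HomologicalComplex.mapBifunctorDesc (fun p' q' h' =>
      eqToHom (by
        have h : p' + q' = n := h'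
        obtain ⟨hj⟩ : PLift (q ((Equiv.ofBijective q hq).symm q') = q') :=
          ⟨(Equiv.ofBijective q hq).apply_symm_apply q'⟩
        have hj' := hpq ((Equiv.ofBijective q hq).symm q')
        rw [hj, show p ((Equiv.ofBijective q hq).symm q') = p' by lia]) ≫
        s.inj ((Equiv.ofBijective q hq).symm q')))
    (fun s j => by
      refine (HomologicalComplex.ι_mapBifunctorDesc _ (p j) (q j) (hpq j)).trans ?_
      have h (j' : J) (hj' : j' = j) (w) : eqToHom w ≫ s.inj j' = s.inj j := by
        subst hj'
        exact Category.id_comp _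
      exact h _ ((Equiv.ofBijective q hq).symm_apply_apply j) _)
    (fun s m hm => by
      refine S.tensor_hom_ext fun p' q' h' => ?_
      obtain ⟨j, rfl⟩ := hq.2 q'
      obtain rfl : p' = p j := by
        have := hpq j
        lia
      refine (hm j).trans ?_
      symm
      refine (HomologicalComplex.ι_mapBifunctorDesc _ (p j) (q j) (hpq j)).trans ?_
      have h (j' : J) (hj' : j' = j) (w) : eqToHom w ≫ s.inj j' = s.inj j := by
        subst hj'
        exact Category.id_comp _
      exact h _ ((Equiv.ofBijective q hq).symm_apply_apply j) _)

variable (G : ℤ → A₂)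

/-- The inclusion of the summand `T((C₁)_p, G_q)` of `T(C₁, G)`, for a family `G` regarded as
a complex with zero differential. -/
def ι₀ (p q n : ℤ) (h : p + q = n) :
    (S.T.obj (C₁.X p)).obj (G q) ⟶ (S.tensor C₁ (zeroComplex G)).X n :=
  S.ι C₁ (zeroComplex G) p q n h

/-- The degree `n` term of `T(C₁, G)` as a coproduct. -/
def isColimitTensorZeroComplex {J : Type} (n : ℤ) (p q : J → ℤ) (hpq : ∀ j, p j + q j = n)
    (hq : Function.Bijective q) :
    IsColimit (Cofan.mk ((S.tensor C₁ (zeroComplex G)).X n)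
      (fun j => S.ι₀ C₁ G (p j) (q j) n (hpq j))) :=
  S.isColimitTensor C₁ (zeroComplex G) n p q hpq hq

lemma ι₀_d (p q n p' n' : ℤ) (h : p + q = n) (hp : p' + 1 = p) (hn : n' + 1 = n) :
    S.ι₀ C₁ G p q n h ≫ (S.tensor C₁ (zeroComplex G)).d n n' =
      (S.T.map (C₁.d p p')).app (G q) ≫ S.ι₀ C₁ G p' q n' (by lia) := by
  have h₀ : (S.T.obj (C₁.X p)).map ((zeroComplex G).d q (q - 1)) = 0 := Functor.map_zero _ _ _
  have e := S.ι_d C₁ (zeroComplex G) p q n p' (q - 1) n' h hp (by lia) hn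
  rw [h₀, zero_comp, smul_zero, add_zero] at e
  exact e

/-- The morphism `T(Z_p(C₁), G_q) ⟶ Z_n(T(C₁, G))`. -/
def zι (p q n : ℤ) (h : p + q = n) :
    (S.T.obj (C₁.cycles p)).obj (G q) ⟶ (S.tensor C₁ (zeroComplex G)).cycles n :=
  (S.tensor C₁ (zeroComplex G)).liftCycles
    ((S.T.map (C₁.iCycles p)).app (G q) ≫ S.ι₀ C₁ G p q n h) (n - 1) (by simp) (by
      rw [Category.assoc, S.ι₀_d C₁ G p q n (p - 1) (n - 1) h (by lia) (by lia),
        reassoc_of% (S.map_app_comp_map_app (C₁.iCycles_d p (p - 1)) (G q)), zero_comp])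

@[simp]
lemma zι_iCycles (p q n : ℤ) (h : p + q = n) :
    S.zι C₁ G p q n h ≫ (S.tensor C₁ (zeroComplex G)).iCycles n =
      (S.T.map (C₁.iCycles p)).app (G q) ≫ S.ι₀ C₁ G p q n h :=
  HomologicalComplex.liftCycles_i _ _ _ _ _

lemma ι₀_toCycles (p q n p' n' : ℤ) (h : p + q = n) (hp : p' + 1 = p) (hn : n' + 1 = n) :
    S.ι₀ C₁ G p q n h ≫ (S.tensor C₁ (zeroComplex G)).toCycles n n' =
      (S.T.map (C₁.toCycles p p')).app (G q) ≫ S.zι C₁ G p' q n' (by lia) := by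
  rw [← cancel_mono ((S.tensor C₁ (zeroComplex G)).iCycles n'), Category.assoc,
    HomologicalComplex.toCycles_i, S.ι₀_d C₁ G p q n p' n' h hp hn, Category.assoc,
    zι_iCycles, ← NatTrans.comp_app_assoc, ← Functor.map_comp, HomologicalComplex.toCycles_i]

lemma map_toCycles_zι (p q n : ℤ) (h : p + q = n) :
    (S.T.map (C₁.toCycles (p + 1) p)).app (G q) ≫ S.zι C₁ G p q n h ≫
      (S.tensor C₁ (zeroComplex G)).homologyπ n = 0 := by
  rw [← reassoc_of% (S.ι₀_toCycles C₁ G (p + 1) q (n + 1) p n (by lia) rfl rfl),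
    HomologicalComplex.toCycles_comp_homologyπ, comp_zero]

/-- The morphism `T(H_p(C₁), G_q) ⟶ H_n(T(C₁, G))`. -/
def hι (p q n : ℤ) (h : p + q = n) :
    (S.T.obj (C₁.homology p)).obj (G q) ⟶ (S.tensor C₁ (zeroComplex G)).homology n :=
  descHomology (S.T.flip.obj (G q)) C₁ p
    (S.zι C₁ G p q n h ≫ (S.tensor C₁ (zeroComplex G)).homologyπ n)
    (S.map_toCycles_zι C₁ G p q n h)

lemma π_hι (p q n : ℤ) (h : p + q = n) :
    (S.T.map (C₁.homologyπ p)).app (G q) ≫ S.hι C₁ G p q n h =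
      S.zι C₁ G p q n h ≫ (S.tensor C₁ (zeroComplex G)).homologyπ n :=
  π_descHomology (S.T.flip.obj (G q)) C₁ p _ _

end

section

variable [HasColimits A₃] [AB5 A₃] (C₁ : ChainComplex A₁ ℤ) (G : ℤ → A₂)

variable {G} in
/-- The cycles of `T(C₁, G)` as a coproduct, when the `G_q` are flat. -/
def isColimitCycles (hG : ∀ q, S.flat₂ (G q)) {J : Type} (n : ℤ) (p q : J → ℤ)
    (hpq : ∀ j, p j + q j = n) (hq : Function.Bijective q) :
    IsColimit (Cofan.mk ((S.tensor C₁ (zeroComplex G)).cycles n)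
      (fun j => S.zι C₁ G (p j) (q j) n (hpq j))) := by
  have := hasExactColimitsOfShape_discrete (A := A₃) J
  let c := Cofan.mk ((S.tensor C₁ (zeroComplex G)).cycles n)
      (fun j => S.zι C₁ G (p j) (q j) n (hpq j))
  let t := Sigma.desc c.inj
  let w := t ≫ (S.tensor C₁ (zeroComplex G)).iCycles n
  have hw (j : J) : Sigma.ι (fun j => (S.T.obj (C₁.cycles (p j))).obj (G (q j))) j ≫ w =
      (S.T.map (C₁.iCycles (p j))).app (G (q j)) ≫
        S.ι₀ C₁ G (p j) (q j) n (hpq j) := by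
    rw [Sigma.ι_desc_assoc]
    exact S.zι_iCycles _ _ _ _ _ _
  have hw₀ : w ≫ (S.tensor C₁ (zeroComplex G)).d n (n - 1) = 0 := by
    rw [Category.assoc, HomologicalComplex.iCycles_d, comp_zero]
  -- Flatness of the `G q` and exactness of coproducts make `w` a kernel of the differential; the
  -- comparison `t` with the cycles is then both mono and epi.
  have hmono : Mono w := mono_of_isColimit_cofan
    (fun j => (S.T.map (C₁.iCycles (p j))).app (G (q j))) (fun j => hG _ _) w _ _
    (coproductIsCoproduct _) (S.isColimitTensorZeroComplex C₁ G n p q hpq hq) hw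
  let E (j : J) : ShortComplex A₁ :=
    ShortComplex.mk (C₁.iCycles (p j)) (C₁.d (p j) (p j - 1)) (by simp)
  have hE (j : J) : (E j).Exact :=
    ShortComplex.exact_of_f_is_kernel _ (C₁.cyclesIsKernel (p j) (p j - 1) (by simp))
  have hpq' (j : J) : p j - 1 + q j = n - 1 := by
    rw [← hpq j]
    lia
  have hexact : (ShortComplex.mk w _ hw₀).Exact :=
    exact_of_isColimit_cofan (fun j => (hG (q j)).exact_map S (hE j))
      (fun j =>
        { τ₁ := Sigma.ι (fun j => (S.T.obj (C₁.cycles (p j))).obj (G (q j))) j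
          τ₂ := S.ι₀ C₁ G (p j) (q j) n (hpq j)
          τ₃ := S.ι₀ C₁ G (p j - 1) (q j) (n - 1) (hpq' j)
          comm₁₂ := hw j
          comm₂₃ := S.ι₀_d C₁ G (p j) (q j) n (p j - 1) (n - 1) (hpq j)
            (by lia) (by lia) })
      (coproductIsCoproduct _) (S.isColimitTensorZeroComplex C₁ G n p q hpq hq)
      (S.isColimitTensorZeroComplex C₁ G (n - 1) (fun j => p j - 1) q hpq' hq)
  have : Mono t := mono_of_mono_fac (rfl : t ≫ (S.tensor C₁ (zeroComplex G)).iCycles n = w)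
  have : Epi t := by
    rw [epi_iff_surjective_up_to_refinements]
    intro B x
    obtain ⟨B', π, hπ, y, hy⟩ := hexact.exact_up_to_refinements
      (x ≫ (S.tensor C₁ (zeroComplex G)).iCycles n) (by simp)
    refine ⟨B', π, hπ, y, ?_⟩
    rw [← cancel_mono ((S.tensor C₁ (zeroComplex G)).iCycles n), Category.assoc, Category.assoc]
    exact hy
  have : IsIso (Sigma.desc c.inj) := isIso_of_mono_of_epi t
  exact Cofan.isColimitOfIsIsoSigmaDesc c

variable {G} in
/-- The homology of `T(C₁, G)` as a coproduct, when the `G_q` are flat. -/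
def isColimitHomology (hG : ∀ q, S.flat₂ (G q)) {J : Type} (n : ℤ) (p q : J → ℤ)
    (hpq : ∀ j, p j + q j = n) (hq : Function.Bijective q) :
    IsColimit (Cofan.mk ((S.tensor C₁ (zeroComplex G)).homology n)
      (fun j => S.hι C₁ G (p j) (q j) n (hpq j))) := by
  let D := S.tensor C₁ (zeroComplex G)
  let hZ := S.isColimitCycles C₁ hG n p q hpq hq
  let hD := S.isColimitTensorZeroComplex C₁ G (n + 1) (fun j => p j + 1) q
    (fun j => by rw [← hpq j]; lia) hq
  -- Homology is the cokernel of `toCycles`, so once the cycles are a coproduct a cofan out of the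
  -- `T(H_p, G_q)` extends to the cycles and descends to homology.
  let a (s : Cofan (fun j => (S.T.obj (C₁.homology (p j))).obj (G (q j)))) : D.cycles n ⟶ s.pt :=
    Cofan.IsColimit.desc hZ (fun j => (S.T.map (C₁.homologyπ (p j))).app (G (q j)) ≫ s.inj j)
  have ha (s) (j) : S.zι C₁ G (p j) (q j) n (hpq j) ≫ a s =
      (S.T.map (C₁.homologyπ (p j))).app (G (q j)) ≫ s.inj j :=
    Cofan.IsColimit.fac hZ _ j
  have ha' (s) : D.toCycles (n + 1) n ≫ a s = 0 := by
    refine Cofan.IsColimit.hom_ext hD _ _ fun j => ?_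
    change S.ι₀ C₁ G (p j + 1) (q j) (n + 1) _ ≫ _ = _ ≫ 0
    rw [comp_zero, reassoc_of% (S.ι₀_toCycles C₁ G (p j + 1) (q j) (n + 1) (p j) n
      (by rw [← hpq j]; lia) rfl rfl), ha,
      reassoc_of% (S.map_app_comp_map_app (C₁.toCycles_comp_homologyπ (p j + 1) (p j)) (G (q j))),
      zero_comp]
  refine Cofan.IsColimit.mk _
    (fun s => (D.homologyIsCokernel (n + 1) n (by simp)).desc (CokernelCofork.ofπ (a s) (ha' s)))
    (fun s j => ?_) (fun s m hm => ?_)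
  · change S.hι C₁ G (p j) (q j) n _ ≫ _ = _
    rw [← cancel_epi ((S.T.map (C₁.homologyπ (p j))).app (G (q j))),
      reassoc_of% (S.π_hι C₁ G (p j) (q j) n (hpq j))]
    refine (congrArg (_ ≫ ·) ((D.homologyIsCokernel (n + 1) n (by simp)).fac
      (CokernelCofork.ofπ (a s) (ha' s)) WalkingParallelPair.one)).trans (ha s j)
  · rw [← cancel_epi (D.homologyπ n)]
    refine Eq.trans ?_ ((D.homologyIsCokernel (n + 1) n (by simp)).fac
      (CokernelCofork.ofπ (a s) (ha' s)) WalkingParallelPair.one).symm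
    refine Cofan.IsColimit.hom_ext hZ _ _ fun j => ?_
    refine Eq.trans ?_ (ha s j).symm
    change S.zι C₁ G (p j) (q j) n (hpq j) ≫ _ = _
    rw [← reassoc_of% (S.π_hι C₁ G (p j) (q j) n (hpq j))]
    exact congrArg (_ ≫ ·) (hm j)

end

end BiadditiveTHC

/-! ### The short exact sequences relating cycles, boundaries and homology -/

section CyclesAndBoundaries

variable {A : Type u} [Category.{v} A] [Abelian A] (C : ChainComplex A ℤ) (q : ℤ)

/-- The boundaries in degree `q - 1`, as the image of `d : C_q ⟶ C_{q-1}`. -/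
abbrev dImage : A := Limits.image (C.d q (q - 1))

/-- The epimorphism from `C_q` to the boundaries in degree `q - 1`. -/
def dImageπ : C.X q ⟶ dImage C q := factorThruImage (C.d q (q - 1))

instance : Epi (dImageπ C q) := inferInstanceAs (Epi (factorThruImage (C.d q (q - 1))))

lemma d_dImageπ (p : ℤ) : C.d p q ≫ dImageπ C q = 0 := by
  rw [← cancel_mono (Limits.image.ι (C.d q (q - 1))), Category.assoc, zero_comp]
  exact (congrArg (_ ≫ ·) (Limits.image.fac _)).trans (C.d_comp_d _ _ _)

/-- The inclusion of boundaries into cycles. -/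
def dImageι : dImage C q ⟶ C.cycles (q - 1) :=
  C.liftCycles (Limits.image.ι (C.d q (q - 1))) (q - 1 - 1) (by simp) (by
    rw [← cancel_epi (dImageπ C q), comp_zero]
    exact (Limits.image.fac_assoc _ _).trans (C.d_comp_d _ _ _))

lemma dImageι_iCycles : dImageι C q ≫ C.iCycles (q - 1) = Limits.image.ι (C.d q (q - 1)) :=
  HomologicalComplex.liftCycles_i _ _ _ _ _

lemma dImageπ_dImageι : dImageπ C q ≫ dImageι C q = C.toCycles q (q - 1) := by
  rw [← cancel_mono (C.iCycles (q - 1)), Category.assoc, dImageι_iCycles,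
    HomologicalComplex.toCycles_i]
  exact Limits.image.fac _

instance : Mono (dImageι C q) := mono_of_mono_fac (dImageι_iCycles C q)

lemma iCycles_dImageπ : C.iCycles q ≫ dImageπ C q = 0 := by
  rw [← cancel_mono (Limits.image.ι (C.d q (q - 1))), Category.assoc, zero_comp]
  exact (congrArg (_ ≫ ·) (Limits.image.fac _)).trans (C.iCycles_d _ _)

lemma dImageι_homologyπ : dImageι C q ≫ C.homologyπ (q - 1) = 0 := by
  rw [← cancel_epi (dImageπ C q), comp_zero, reassoc_of% (dImageπ_dImageι C q),
    HomologicalComplex.toCycles_comp_homologyπ]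

lemma shortExact_cycles : (ShortComplex.mk _ _ (iCycles_dImageπ C q)).ShortExact where
  exact := by
    have h : (ShortComplex.mk (C.iCycles q) (C.d q (q - 1)) (by simp)).Exact :=
      ShortComplex.exact_of_f_is_kernel _ (C.cyclesIsKernel q (q - 1) (by simp))
    rw [ShortComplex.exact_iff_exact_up_to_refinements] at h ⊢
    intro B x hx
    exact h x (by
      refine (congrArg (x ≫ ·) (Limits.image.fac (C.d q (q - 1)))).symm.trans ?_
      exact (Category.assoc _ _ _).symm.trans ((congrArg (· ≫ _) hx).trans zero_comp))
  mono_f := inferInstanceAs (Mono (C.iCycles q))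
  epi_g := inferInstanceAs (Epi (dImageπ C q))

/-- When the cycles are flat, this is the presentation of the homology that computes `Tor₁`. -/
lemma shortExact_homology : (ShortComplex.mk _ _ (dImageι_homologyπ C q)).ShortExact where
  exact := by
    have h : (ShortComplex.mk (C.toCycles q (q - 1)) (C.homologyπ (q - 1)) (by simp)).Exact :=
      ShortComplex.exact_of_g_is_cokernel _ (C.homologyIsCokernel q (q - 1) (by simp))
    rw [ShortComplex.exact_iff_exact_up_to_refinements] at h ⊢
    intro B x hx
    obtain ⟨B', π, hπ, y, hy⟩ := h x hx
    refine ⟨B', π, hπ, y ≫ dImageπ C q, ?_⟩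
    rw [Category.assoc]
    exact hy.trans (congrArg (y ≫ ·) (dImageπ_dImageι C q)).symm
  mono_f := inferInstanceAs (Mono (dImageι C q))
  epi_g := inferInstanceAs (Epi (C.homologyπ (q - 1)))

/-- The inclusion of cycles, as a morphism of complexes. -/
def cyclesInclusion : zeroComplex (fun q => C.cycles q) ⟶ C where
  f q := C.iCycles q
  comm' q q' _ := (C.iCycles_d q q').trans zero_comp.symm

/-- The projection onto boundaries, as a morphism of complexes. -/
def boundariesProjection : C ⟶ zeroComplex (fun q => dImage C q) where
  f q := dImageπ C q
  comm' q q' _ := comp_zero.trans (d_dImageπ C q' q).symm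

lemma cyclesInclusion_boundariesProjection :
    cyclesInclusion C ≫ boundariesProjection C = 0 := by
  ext q
  exact iCycles_dImageπ C q

end CyclesAndBoundaries

/-! ### The long exact sequence and its connecting morphism -/

namespace BiadditiveTHC

variable {A₁ : Type u₁} {A₂ : Type u₂} {A₃ : Type u₃}
  [Category.{v₁} A₁] [Category.{v₂} A₂] [Category.{v₃} A₃]
  [Abelian A₁] [Abelian A₂] [Abelian A₃]
  (S : BiadditiveTHC A₁ A₂ A₃)

lemma flat₂_dImage {C : ChainComplex A₂ ℤ} (hB : ∀ n : ℤ, S.flat₂ (boundaries C n)) (q : ℤ) :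
    S.flat₂ (dImage C q) := by
  have h (n q : ℤ) (hn : n + 1 = q) : S.flat₂ (Limits.image (C.d q n)) := by
    subst hn
    exact hB n
  exact h _ _ (by lia)

variable [HasColimits A₃] (C₁ : ChainComplex A₁ ℤ)

section

variable {K L M : ChainComplex A₂ ℤ}

/-- The morphism `T(C₁, f)`. -/
def tensorMap (f : K ⟶ L) : S.tensor C₁ K ⟶ S.tensor C₁ L :=
  HomologicalComplex.mapBifunctorMap (𝟙 C₁) f S.T (ComplexShape.down ℤ)

lemma ι_tensorMap (f : K ⟶ L) (p q n : ℤ) (h : p + q = n) :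
    S.ι C₁ K p q n h ≫ (S.tensorMap C₁ f).f n =
      (S.T.obj (C₁.X p)).map (f.f q) ≫ S.ι C₁ L p q n h := by
  refine (HomologicalComplex.ι_mapBifunctorMap _ _ _ _ p q n h).trans ?_
  rw [HomologicalComplex.id_f, CategoryTheory.Functor.map_id, NatTrans.id_app,
    Category.id_comp]

lemma tensorMap_comp_tensorMap {f : K ⟶ L} {g : L ⟶ M} (w : f ≫ g = 0) :
    S.tensorMap C₁ f ≫ S.tensorMap C₁ g = 0 := by
  refine HomologicalComplex.hom_ext _ _ fun n => S.tensor_hom_ext fun p q h => ?_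
  have hw : f.f q ≫ g.f q = 0 := by
    rw [← HomologicalComplex.comp_f, w, HomologicalComplex.zero_f]
  rw [HomologicalComplex.comp_f, reassoc_of% (S.ι_tensorMap C₁ f p q n h), S.ι_tensorMap,
    ← Functor.map_comp_assoc, hw, Functor.map_zero, zero_comp, HomologicalComplex.zero_f,
    comp_zero]

variable [AB5 A₃] in
/-- `T(C₁, -)` preserves the exactness of `0 ⟶ K ⟶ L ⟶ M ⟶ 0` if `M` is degreewise flat. -/
lemma shortExact_tensorMap (h₁ : IsLeftCompleteCotorsionTheory S.flat₁ (rightPerp S.flat₁))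
    {f : K ⟶ L} {g : L ⟶ M} (w : f ≫ g = 0)
    (hw : ∀ q, (ShortComplex.mk (f.f q) (g.f q) (by
      rw [← HomologicalComplex.comp_f, w, HomologicalComplex.zero_f])).ShortExact)
    (hM : ∀ q, S.flat₂ (M.X q)) :
    (ShortComplex.mk _ _ (S.tensorMap_comp_tensorMap C₁ w)).ShortExact := by
  refine HomologicalComplex.shortExact_of_degreewise_shortExact _ fun n => ?_
  have := hasExactColimitsOfShape_discrete (A := A₃) ℤ
  have hpq (q : ℤ) : n - q + q = n := by lia
  let hc (C : ChainComplex A₂ ℤ) :=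
    S.isColimitTensor C₁ C n (fun q => n - q) id hpq Function.bijective_id
  exact
    { exact := exact_of_isColimit_cofan
        (fun q => S.exact_map_right (C₁.X (n - q)) (hw q).exact (hw q).epi_g)
        (fun q =>
          { τ₁ := S.ι C₁ K (n - q) q n (hpq q)
            τ₂ := S.ι C₁ L (n - q) q n (hpq q)
            τ₃ := S.ι C₁ M (n - q) q n (hpq q)
            comm₁₂ := S.ι_tensorMap C₁ f _ _ _ _
            comm₂₃ := S.ι_tensorMap C₁ g _ _ _ _ }) (hc K) (hc L) (hc M)
      mono_f := mono_of_isColimit_cofan _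
        -- The terms of `C₁` need not be flat; flatness of the quotient `M` compensates, by the
        -- snake lemma against a flat cover of each term.
        (fun q => S.mono_map_of_flat₂ (h₁.shortExact_cover (C₁.X (n - q))) (h₁.cover_mem _)
          (hw q) (hM q)) _ _ _ (hc K) (hc L) (fun q => S.ι_tensorMap C₁ f _ _ _ _)
      epi_g := by
        have : Epi ((S.tensorMap C₁ g).f n) := by
          refine ⟨fun a b hab => S.tensor_hom_ext fun p q h => ?_⟩
          have := (hw q).epi_g
          have : Epi (g.f q) := this
          rw [← cancel_epi ((S.T.obj (C₁.X p)).map (g.f q)),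
            ← reassoc_of% (S.ι_tensorMap C₁ g p q n h), hab,
            reassoc_of% (S.ι_tensorMap C₁ g p q n h)]
        exact this }

end

variable (C₂ : ChainComplex A₂ ℤ)

/-- `T(C₁, Z(C₂)) ⟶ T(C₁, C₂) ⟶ T(C₁, B(C₂))`. -/
abbrev cyclesBoundaries : ShortComplex (ChainComplex A₃ ℤ) :=
  ShortComplex.mk _ _ (S.tensorMap_comp_tensorMap C₁ (cyclesInclusion_boundariesProjection C₂))

variable [AB5 A₃] in
variable {C₂} in
lemma shortExact_cyclesBoundaries
    (h₁ : IsLeftCompleteCotorsionTheory S.flat₁ (rightPerp S.flat₁))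
    (hB : ∀ q, S.flat₂ (dImage C₂ q)) : (S.cyclesBoundaries C₁ C₂).ShortExact :=
  S.shortExact_tensorMap C₁ h₁ (cyclesInclusion_boundariesProjection C₂)
    (fun q => shortExact_cycles C₂ q) hB

lemma hι_homologyMap (p q n : ℤ) (h : p + q = n) :
    S.hι C₁ (fun q => C₂.cycles q) p q n h ≫
      HomologicalComplex.homologyMap (S.cyclesBoundaries C₁ C₂).f n = S.γAux C₁ C₂ p q n h := by
  rw [← cancel_epi ((S.T.map (C₁.homologyπ p)).app (C₂.cycles q)),
    reassoc_of% (S.π_hι C₁ (fun q => C₂.cycles q) p q n h), π_γAux,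
    HomologicalComplex.homologyπ_naturality, ← Category.assoc]
  congr 1
  rw [← cancel_mono ((S.tensor C₁ C₂).iCycles n), cyclesMap_i, Category.assoc,
    HomologicalComplex.cyclesMap_i,
    reassoc_of% (S.zι_iCycles C₁ (fun q => C₂.cycles q) p q n h)]
  exact congrArg (_ ≫ ·) (S.ι_tensorMap C₁ (cyclesInclusion C₂) p q n h)

/-- This ties `γ` to the long exact sequence: on each summand, the map induced by the inclusion of
cycles factors through `γ`. -/
lemma map_homologyπ_γComponent (p q n : ℤ) (h : p + q = n) :
    (S.T.obj (C₁.homology p)).map (C₂.homologyπ q) ≫ S.γComponent C₁ C₂ p q n h =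
      S.hι C₁ (fun q => C₂.cycles q) p q n h ≫
        HomologicalComplex.homologyMap (S.cyclesBoundaries C₁ C₂).f n := by
  rw [hι_homologyMap]
  exact π_descHomology _ _ _ _ _

variable {C₂} in
/-- The connecting morphism on the summand `T(H_p(C₁), B_{q-1}(C₂))` is induced by the inclusion
of boundaries into cycles, up to the sign `(-1)^p`. -/
lemma hι_δ (hS : (S.cyclesBoundaries C₁ C₂).ShortExact) (p q n m : ℤ) (h : p + q = n)
    (hm : m + 1 = n) :
    S.hι C₁ (fun q => dImage C₂ q) p q n h ≫ hS.δ n m hm =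
      Int.negOnePow p • ((S.T.obj (C₁.homology p)).map (dImageι C₂ q) ≫
        S.hι C₁ (fun q => C₂.cycles q) p (q - 1) m (by lia)) := by
  -- The connecting morphism is evaluated on `T(Z_p(C₁), (C₂)_q)`, where a lift to `T(C₁, C₂)` is
  -- visible. The first factor consists of cycles, so only `(-1)^p T(1, d)` survives in the
  -- differential of this lift.
  let x₂ := (S.T.map (C₁.iCycles p)).app (C₂.X q) ≫ S.ι C₁ C₂ p q n h
  let x₁ := Int.negOnePow p • ((S.T.map (C₁.iCycles p)).app (C₂.X q) ≫
    (S.T.obj (C₁.X p)).map (C₂.toCycles q (q - 1)) ≫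
      S.ι₀ C₁ (fun q => C₂.cycles q) p (q - 1) m (by lia))
  let x₃ := (S.T.obj (C₁.cycles p)).map (dImageπ C₂ q) ≫ S.zι C₁ (fun q => dImage C₂ q) p q n h ≫
    (S.cyclesBoundaries C₁ C₂).X₃.iCycles n
  have hx₂ : x₂ ≫ (S.cyclesBoundaries C₁ C₂).g.f n = x₃ := by
    dsimp only [x₂, x₃]
    rw [Category.assoc, S.zι_iCycles, NatTrans.naturality_assoc]
    exact congrArg (_ ≫ ·) (S.ι_tensorMap C₁ (boundariesProjection C₂) p q n h)
  have hx₁ : x₁ ≫ (S.cyclesBoundaries C₁ C₂).f.f m = x₂ ≫ (S.cyclesBoundaries C₁ C₂).X₂.d n m := by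
    have e : S.ι₀ C₁ (fun q => C₂.cycles q) p (q - 1) m (by lia) ≫
        (S.cyclesBoundaries C₁ C₂).f.f m =
        (S.T.obj (C₁.X p)).map (C₂.iCycles (q - 1)) ≫ S.ι C₁ C₂ p (q - 1) m (by lia) :=
      S.ι_tensorMap C₁ (cyclesInclusion C₂) p (q - 1) m (by lia)
    dsimp only [x₁, x₂]
    rw [Linear.units_smul_comp, Category.assoc, Category.assoc, e, Category.assoc,
      S.ι_d C₁ C₂ p q n (p - 1) (q - 1) m h (by lia) (by lia) hm, Preadditive.comp_add,
      reassoc_of% (S.map_app_comp_map_app (C₁.iCycles_d p (p - 1)) (C₂.X q)), zero_comp, zero_add,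
      Linear.comp_units_smul, ← Functor.map_comp_assoc, HomologicalComplex.toCycles_i]
  have hx₃ : x₃ ≫ (S.cyclesBoundaries C₁ C₂).X₃.d n m = 0 := by
    dsimp only [x₃]
    rw [Category.assoc, Category.assoc, HomologicalComplex.iCycles_d, comp_zero, comp_zero]
  have key := hS.δ_eq n m hm x₃ hx₃ x₂ hx₂ x₁ hx₁ (m - 1) (by simp)
  have e₃ : (S.cyclesBoundaries C₁ C₂).X₃.liftCycles x₃ m (ComplexShape.next_eq' _ hm) hx₃ =
      (S.T.obj (C₁.cycles p)).map (dImageπ C₂ q) ≫ S.zι C₁ (fun q => dImage C₂ q) p q n h := by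
    rw [← cancel_mono ((S.cyclesBoundaries C₁ C₂).X₃.iCycles n),
      HomologicalComplex.liftCycles_i, Category.assoc]
  have e₁ (w) : (S.cyclesBoundaries C₁ C₂).X₁.liftCycles x₁ (m - 1) (by simp) w =
      Int.negOnePow p • ((S.T.obj (C₁.cycles p)).map (C₂.toCycles q (q - 1)) ≫
        S.zι C₁ (fun q => C₂.cycles q) p (q - 1) m (by lia)) := by
    rw [← cancel_mono ((S.cyclesBoundaries C₁ C₂).X₁.iCycles m),
      HomologicalComplex.liftCycles_i, Linear.units_smul_comp, Category.assoc]
    dsimp only [x₁]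
    rw [S.zι_iCycles, NatTrans.naturality_assoc]
  rw [e₃, e₁, Linear.units_smul_comp, Category.assoc, Category.assoc] at key
  -- `T(Z_p(C₁), (C₂)_q)` maps onto `T(H_p(C₁), B_{q-1}(C₂))`, so checking the formula there is
  -- enough.
  rw [← cancel_epi ((S.T.map (C₁.homologyπ p)).app (dImage C₂ q)),
    ← cancel_epi ((S.T.obj (C₁.cycles p)).map (dImageπ C₂ q)),
    reassoc_of% (S.π_hι C₁ (fun q => dImage C₂ q) p q n h)]
  refine key.trans ?_
  rw [Linear.comp_units_smul, Linear.comp_units_smul, ← NatTrans.naturality_assoc,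
    S.π_hι C₁ (fun q => C₂.cycles q) p (q - 1) m (by lia), ← Functor.map_comp_assoc, dImageπ_dImageι]

end BiadditiveTHC

/-! ### Extracting an extension from an exact sequence -/

section

variable {A : Type u} [Category.{v} A] [Abelian A]

/-- In an exact sequence `U' ⟶ U ⟶ W ⟶ X ⟶ Y`, the object `W` is an extension of the kernel
of the last morphism by the cokernel of the first one. -/
lemma exists_shortExact_of_exact {U' U V W X Y N : A} {a : U' ⟶ U} {b : U ⟶ W} {c : W ⟶ X}
    {d : X ⟶ Y} {π : U ⟶ V} {γ : V ⟶ W} {κ : N ⟶ X} {wab : a ≫ b = 0} {wbc : b ≫ c = 0}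
    {wcd : c ≫ d = 0} {wκd : κ ≫ d = 0}
    (hab : (ShortComplex.mk a b wab).Exact) (hbc : (ShortComplex.mk b c wbc).Exact)
    (hcd : (ShortComplex.mk c d wcd).Exact) (waπ : a ≫ π = 0) [Epi π]
    (hκd : (ShortComplex.mk κ d wκd).Exact) [Mono κ] (hγ : π ≫ γ = b) :
    ∃ (β : W ⟶ N) (w : γ ≫ β = 0), (ShortComplex.mk γ β w).ShortExact := by
  rw [ShortComplex.exact_iff_exact_up_to_refinements] at hab hbc hcd
  obtain ⟨β, hβ⟩ : ∃ β, β ≫ κ = c := ⟨hκd.lift c wcd, hκd.lift_f c wcd⟩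
  have w : γ ≫ β = 0 := by
    rw [← cancel_epi π, ← cancel_mono κ, Category.assoc, Category.assoc, hβ, reassoc_of% hγ, wbc,
      comp_zero, zero_comp]
  refine ⟨β, w,
    { exact := ?_
      mono_f := ?_
      epi_g := ?_ }⟩
  · rw [ShortComplex.exact_iff_exact_up_to_refinements]
    intro B x hx
    obtain ⟨B', p, hp, y, hy⟩ := hbc x (by
      refine (congrArg (x ≫ ·) hβ).symm.trans ?_
      exact (Category.assoc _ _ _).symm.trans ((congrArg (· ≫ κ) hx).trans zero_comp))
    refine ⟨B', p, hp, y ≫ π, hy.trans ?_⟩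
    dsimp only
    rw [Category.assoc, hγ]
  -- `ker π ⊆ ker b = im a ⊆ ker π`: the factorization of `b` through `π` forces `π` to be a
  -- cokernel of `a`, so this need not be assumed.
  · refine Preadditive.mono_of_cancel_zero _ fun {B} x hx => ?_
    obtain ⟨B', p, hp, y, hy⟩ := surjective_up_to_refinements_of_epi π x
    obtain ⟨B'', p', hp', z, hz⟩ := hab y (by
      refine (congrArg (y ≫ ·) hγ).symm.trans ?_
      rw [← Category.assoc, ← hy, Category.assoc, hx, comp_zero])
    dsimp only at hz
    rw [← cancel_epi p, ← cancel_epi p', hy, reassoc_of% hz, waπ]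
    simp only [comp_zero]
  · rw [epi_iff_surjective_up_to_refinements]
    intro B y
    obtain ⟨B', p, hp, x, hx⟩ := hcd (y ≫ κ) (by
      dsimp only
      rw [Category.assoc, wκd, comp_zero])
    refine ⟨B', p, hp, x, ?_⟩
    rw [← cancel_mono κ, Category.assoc, Category.assoc, hβ, hx]

lemma exact_units_smul_right {X Y Z : A} {f : X ⟶ Y} {g : Y ⟶ Z} {w : f ≫ g = 0}
    (h : (ShortComplex.mk f g w).Exact) (s : ℤˣ) :
    (ShortComplex.mk f (s • g) (by rw [Linear.comp_units_smul, w, smul_zero])).Exact := by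
  rw [ShortComplex.exact_iff_exact_up_to_refinements] at h ⊢
  intro B x hx
  refine h x ?_
  dsimp only at hx ⊢
  rw [← one_smul ℤˣ (x ≫ g), ← Int.units_mul_self s, ← smul_smul, ← Linear.comp_units_smul, hx,
    smul_zero]

end

/-! ### The Künneth short exact sequence -/

namespace BiadditiveTHC

variable {A₁ : Type u₁} {A₂ : Type u₂} {A₃ : Type u₃}
  [Category.{v₁} A₁] [Category.{v₂} A₂] [Category.{v₃} A₃]
  [Abelian A₁] [Abelian A₂] [Abelian A₃]
  (S : BiadditiveTHC A₁ A₂ A₃) [HasColimits A₃]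

/-- `Tor₁(X₁, F₃)` is the kernel of `T(X₁, F₁) ⟶ T(X₁, F₂)` for a flat presentation
`0 ⟶ F₁ ⟶ F₂ ⟶ F₃ ⟶ 0`. -/
lemma exists_tor_one_exact
    (h₁ : IsLeftCompleteCotorsionTheory S.flat₁ (rightPerp S.flat₁))
    {X₁ : A₁} {F : ShortComplex A₂} (hF : F.ShortExact) (hF₂ : S.flat₂ F.X₂)
    (R₁ : CompleteResolution S.flat₁ X₁) (R₂ : CompleteResolution S.flat₂ F.X₃) :
    ∃ (k : S.tor R₁ R₂ 1 ⟶ (S.T.obj X₁).obj F.X₁) (w : k ≫ (S.T.obj X₁).map F.f = 0),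
      Mono k ∧ (ShortComplex.mk _ _ w).Exact := by
  obtain ⟨e⟩ := S.nonempty_tor_one_iso h₁ hF hF₂ R₁ R₂
  refine ⟨e.hom ≫ kernel.ι _, by rw [Category.assoc, kernel.condition, comp_zero],
    inferInstance, ?_⟩
  refine ShortComplex.exact_of_f_is_kernel _ (IsLimit.ofIsoLimit (kernelIsKernel _) ?_)
  exact Fork.ext e.symm (by simp)

variable [AB5 A₃] (C₁ : ChainComplex A₁ ℤ) {C₂ : ChainComplex A₂ ℤ}

/-- The Künneth short exact sequence in degree `n`. -/
lemma exists_shortExact_γ_f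
    (h₁ : IsLeftCompleteCotorsionTheory S.flat₁ (rightPerp S.flat₁))
    (hB : ∀ q, S.flat₂ (dImage C₂ q)) (hZ : ∀ q, S.flat₂ (C₂.cycles q))
    (R₁ : ∀ p : ℤ, CompleteResolution S.flat₁ (C₁.homology p))
    (R₂ : ∀ q : ℤ, CompleteResolution S.flat₂ (C₂.homology q)) (n : ℤ) :
    ∃ (β : (S.tensor C₁ C₂).homology n ⟶ (S.torOneComplex C₁ C₂ R₁ R₂).X n)
      (w : (S.γ C₁ C₂).f n ≫ β = 0), (ShortComplex.mk _ _ w).ShortExact := by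
  have hS := S.shortExact_cyclesBoundaries C₁ h₁ hB
  let J := { x : ℤ × ℤ // x.1 + x.2 = n }
  have hJ : Function.Bijective (fun x : J => x.1.2) :=
    ⟨fun x y (h : x.1.2 = y.1.2) => Subtype.ext (Prod.ext (by
      have hx := x.2
      have hy := y.2
      lia) h), fun q => ⟨⟨(n - q, q), by simp⟩, rfl⟩⟩
  -- The single index set `J` serves all the coproducts, in degrees `n - 1`, `n` and `n + 1`.
  -- Shifting the bidegrees keeps the boundaries indexed by `q` facing the cycles indexed by `q -
  -- 1`.
  have hJ' : Function.Bijective (fun x : J => x.1.2 - 1) :=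
    (Equiv.subRight (1 : ℤ)).bijective.comp hJ
  have := hasExactColimitsOfShape_discrete (A := A₃) J
  have e₁ (x : J) : x.1.1 + (x.1.2 - 1) = n - 1 := by
    have := x.2
    lia
  have e₂ (x : J) : x.1.1 + 1 + (x.1.2 - 1) = n := by
    have := x.2
    lia
  have e₃ (x : J) : x.1.1 + 1 + x.1.2 = n + 1 := by
    have := x.2
    lia
  have hm : n - 1 + 1 = n := by lia
  -- the morphism from the `Tor` terms
  have hex (x : J) : ∃ (k : S.tor (R₁ x.1.1) (R₂ (x.1.2 - 1)) 1 ⟶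
      (S.T.obj (C₁.homology x.1.1)).obj (dImage C₂ x.1.2))
      (w : k ≫ (S.T.obj (C₁.homology x.1.1)).map (dImageι C₂ x.1.2) = 0),
      Mono k ∧ (ShortComplex.mk _ _ w).Exact :=
    S.exists_tor_one_exact h₁ (shortExact_homology C₂ x.1.2) (hZ _) _ _
  choose k wk hk hk' using hex
  let ιN (x : J) : S.tor (R₁ x.1.1) (R₂ (x.1.2 - 1)) 1 ⟶ (S.torOneComplex C₁ C₂ R₁ R₂).X n :=
    Sigma.ι (fun x : J => S.tor (R₁ x.1.1) (R₂ (x.1.2 - 1)) 1) x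
  let cN : IsColimit (Cofan.mk _ ιN) := coproductIsCoproduct _
  let κ : (S.torOneComplex C₁ C₂ R₁ R₂).X n ⟶
      (S.tensor C₁ (zeroComplex (fun q => dImage C₂ q))).homology n :=
    Cofan.IsColimit.desc cN
      (fun x => k x ≫ S.hι C₁ (fun q => dImage C₂ q) x.1.1 x.1.2 n x.2)
  have hκ (x : J) : ιN x ≫ κ = k x ≫ S.hι C₁ (fun q => dImage C₂ q) x.1.1 x.1.2 n x.2 :=
    Cofan.IsColimit.fac cN _ x
  let cB := S.isColimitHomology C₁ hB n (fun x : J => x.1.1) (fun x : J => x.1.2)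
    (fun x => x.2) hJ
  have hκ_mono : Mono κ := mono_of_isColimit_cofan k hk κ _ _ cN cB hκ
  have hκδ : κ ≫ hS.δ n (n - 1) hm = 0 := by
    refine Cofan.IsColimit.hom_ext cN _ _ fun x => ?_
    change ιN x ≫ κ ≫ _ = ιN x ≫ 0
    rw [reassoc_of% (hκ x), S.hι_δ C₁ hS _ _ _ _ _ hm, Linear.comp_units_smul,
      reassoc_of% (wk x), zero_comp, smul_zero, comp_zero]
  -- The connecting morphism is the coproduct of the signed maps induced by the inclusions of
  -- boundaries, so its kernel is the coproduct of the `Tor₁` terms.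
  have hκ_exact : (ShortComplex.mk κ _ hκδ).Exact :=
    exact_of_isColimit_cofan (fun x => exact_units_smul_right (hk' x) (Int.negOnePow x.1.1))
      (fun x =>
        { τ₁ := ιN x
          τ₂ := S.hι C₁ (fun q => dImage C₂ q) x.1.1 x.1.2 n x.2
          τ₃ := S.hι C₁ (fun q => C₂.cycles q) x.1.1 (x.1.2 - 1) (n - 1) (e₁ x)
          comm₁₂ := hκ x
          comm₂₃ := (S.hι_δ C₁ hS _ _ _ _ x.2 hm).trans
            (Linear.units_smul_comp _ _ _).symm })
      cN cB
      (S.isColimitHomology C₁ hZ (n - 1) (fun x : J => x.1.1) (fun x : J => x.1.2 - 1)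
        e₁ hJ')
  -- the projection to `T(H(C₁), H(C₂))`
  let cZ := S.isColimitHomology C₁ hZ n (fun x : J => x.1.1 + 1) (fun x : J => x.1.2 - 1) e₂ hJ'
  let cV := S.isColimitTensorZeroComplex (homologyComplex C₁) (fun q => C₂.homology q) n
    (fun x : J => x.1.1 + 1) (fun x : J => x.1.2 - 1) e₂ hJ'
  let ιV (x : J) : (S.T.obj (C₁.homology (x.1.1 + 1))).obj (C₂.homology (x.1.2 - 1)) ⟶
      (S.tensor (homologyComplex C₁) (homologyComplex C₂)).X n :=
    S.ι₀ (homologyComplex C₁) (fun q => C₂.homology q) (x.1.1 + 1) (x.1.2 - 1) n (e₂ x)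
  let ιZ (x : J) := S.hι C₁ (fun q => C₂.cycles q) (x.1.1 + 1) (x.1.2 - 1) n (e₂ x)
  let ιB (x : J) := S.hι C₁ (fun q => dImage C₂ q) (x.1.1 + 1) x.1.2 (n + 1) (e₃ x)
  let π : (S.tensor C₁ (zeroComplex (fun q => C₂.cycles q))).homology n ⟶
      (S.tensor (homologyComplex C₁) (homologyComplex C₂)).X n :=
    Cofan.IsColimit.desc cZ
      (fun x => (S.T.obj (C₁.homology (x.1.1 + 1))).map (C₂.homologyπ (x.1.2 - 1)) ≫ ιV x)
  have hπ (x : J) : ιZ x ≫ π =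
      (S.T.obj (C₁.homology (x.1.1 + 1))).map (C₂.homologyπ (x.1.2 - 1)) ≫ ιV x :=
    Cofan.IsColimit.fac cZ _ x
  have hπ_epi : Epi π := ⟨fun f g hfg => Cofan.IsColimit.hom_ext cV _ _ fun x => by
    change ιV x ≫ f = ιV x ≫ g
    rw [← cancel_epi ((S.T.obj (C₁.homology (x.1.1 + 1))).map (C₂.homologyπ (x.1.2 - 1))),
      ← reassoc_of% (hπ x), hfg, reassoc_of% (hπ x)]⟩
  have hδ (x : J) : ιB x ≫ hS.δ (n + 1) n rfl = (Int.negOnePow (x.1.1 + 1) •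
      (S.T.obj (C₁.homology (x.1.1 + 1))).map (dImageι C₂ x.1.2)) ≫ ιZ x :=
    (S.hι_δ C₁ hS _ _ _ _ _ rfl).trans (Linear.units_smul_comp _ _ _).symm
  let cB' := S.isColimitHomology C₁ hB (n + 1) (fun x : J => x.1.1 + 1) (fun x : J => x.1.2) e₃ hJ
  have hδπ : hS.δ (n + 1) n rfl ≫ π = 0 := Cofan.IsColimit.hom_ext cB' _ _ fun x => by
    change ιB x ≫ _ ≫ π = ιB x ≫ 0
    rw [reassoc_of% (hδ x), hπ, comp_zero, Linear.units_smul_comp, ← Functor.map_comp_assoc,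
      dImageι_homologyπ, Functor.map_zero, zero_comp, smul_zero]
  have hγ : π ≫ (S.γ C₁ C₂).f n =
      HomologicalComplex.homologyMap (S.cyclesBoundaries C₁ C₂).f n :=
    Cofan.IsColimit.hom_ext cZ _ _ fun x => by
      change ιZ x ≫ π ≫ _ = ιZ x ≫ _
      have h := S.ι_γ C₁ C₂ (x.1.1 + 1) (x.1.2 - 1) n (e₂ x)
      rw [reassoc_of% (hπ x)]
      refine (congrArg (_ ≫ ·) h).trans ?_
      exact S.map_homologyπ_γComponent C₁ C₂ _ _ _ _
  exact exists_shortExact_of_exact (hS.homology_exact₁ (n + 1) n rfl) (hS.homology_exact₂ n)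
    (hS.homology_exact₃ n (n - 1) hm) hδπ hκ_exact hγ

/-- All the differentials vanish, so the degreewise projections automatically form a morphism of
complexes. -/
lemma exists_shortExact_γ
    (h₁ : IsLeftCompleteCotorsionTheory S.flat₁ (rightPerp S.flat₁))
    (hB : ∀ q, S.flat₂ (dImage C₂ q)) (hZ : ∀ q, S.flat₂ (C₂.cycles q))
    (R₁ : ∀ p : ℤ, CompleteResolution S.flat₁ (C₁.homology p))
    (R₂ : ∀ q : ℤ, CompleteResolution S.flat₂ (C₂.homology q)) :
    ∃ (δ : homologyComplex (S.tensor C₁ C₂) ⟶ S.torOneComplex C₁ C₂ R₁ R₂)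
      (w : S.γ C₁ C₂ ≫ δ = 0), (ShortComplex.mk (S.γ C₁ C₂) δ w).ShortExact := by
  choose β w hβ using S.exists_shortExact_γ_f C₁ h₁ hB hZ R₁ R₂
  let δ : homologyComplex (S.tensor C₁ C₂) ⟶ S.torOneComplex C₁ C₂ R₁ R₂ :=
    { f := β
      comm' := fun _ _ _ => comp_zero.trans zero_comp.symm }
  exact ⟨δ, HomologicalComplex.hom_ext _ _ w,
    HomologicalComplex.shortExact_of_degreewise_shortExact _ hβ⟩

end BiadditiveTHC

end THCKunneth
end

theorem mainTheorem3 {A₁ : Type u₁} {A₂ : Type u₂} {A₃ : Type u₃}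
    [Category.{v₁} A₁] [Category.{v₂} A₂] [Category.{v₃} A₃]
    [Abelian A₁] [Abelian A₂] [Abelian A₃] [HasColimits A₃] [AB5 A₃]
    (S : THCKunneth.BiadditiveTHC A₁ A₂ A₃)
    (h₁ : THCKunneth.IsLeftCompleteCotorsionTheory S.flat₁ (THCKunneth.rightPerp S.flat₁))
    (h₂ : THCKunneth.IsLeftCompleteCotorsionTheory S.flat₂ (THCKunneth.rightPerp S.flat₂))
    (C₁ : ChainComplex A₁ ℤ) (C₂ : ChainComplex A₂ ℤ)
    (hB : ∀ n : ℤ, S.flat₂ (THCKunneth.boundaries C₂ n))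
    (hZ : ∀ n : ℤ, S.flat₂ (C₂.cycles n)) :
    (∀ X : A₁, Nonempty (THCKunneth.CompleteResolution S.flat₁ X)) ∧
    (∀ X : A₂, Nonempty (THCKunneth.CompleteResolution S.flat₂ X)) ∧
    ∀ (R₁ : ∀ p : ℤ, THCKunneth.CompleteResolution S.flat₁ (C₁.homology p))
      (R₂ : ∀ q : ℤ, THCKunneth.CompleteResolution S.flat₂ (C₂.homology q)),
      ∃ (δ : THCKunneth.homologyComplex (S.tensor C₁ C₂) ⟶ S.torOneComplex C₁ C₂ R₁ R₂)
        (w : S.γ C₁ C₂ ≫ δ = 0), (ShortComplex.mk (S.γ C₁ C₂) δ w).ShortExact :=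
  ⟨fun X => h₁.nonempty_completeResolution X, fun X => h₂.nonempty_completeResolution X,
    fun R₁ R₂ => S.exists_shortExact_γ C₁ h₁ (S.flat₂_dImage hB) hZ R₁ R₂⟩
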